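/- Let $n\ge 1$. Write points of $\mathbb P^{2n+1}$ as $[z':z'']$ with $z',z''\in\mathbb C^{n+1}$, and use the Euclidean norm on $\mathbb C^{n+1}$ and the corresponding operator norm on $M_{n+1}(\mathbb C)$. An $n$-plane is an $n$-dimensional projective linear subspace of $\mathbb P^{2n+1}$; it has a point of Plücker coordinates in $\mathbb P(\bigwedge^{n+1}\mathbb C^{2n+2})$. For $g\in\mathrm{PGL}_{2n+2}(\mathbb C)$ let $\hat g$ be the induced projective transformation of $\mathbb P(\bigwedge^{n+1}\mathbb C^{2n+2})$ (in matrices, the matrix of all $(n+1)\times(n+1)$ minors). Let $\Gamma\subset\mathrm{PGL}_{2n+2}(\mathbb C)$ be a discrete subgroup. A sequence $(\sigma_\nu)$ of distinct elements of $\Gamma$ is called normal if $(\sigma_\nu)$ and $(\hat\sigma_\nu)$ both have matrix representatives, with largest modulus of an entry equal to $1$, that converge. If $S$ is the limit of such representatives of $\hat\sigma_\nu$, then the projective subspace $[\operatorname{Im}S]$ is the limit image of $(\hat\sigma_\nu)$. An $n$-plane is a limit $n$-plane of $\Gamma$ if its Plücker point lies in the limit image of $(\hat\sigma_\nu)$ for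 some normal sequence $(\sigma_\nu)$ of $\Gamma$. Let $\Lambda$ be the union of all limit $n$-planes and $\Omega=\mathbb P^{2n+1}\setminus\Lambda$. The group $\Gamma$ is of type $\mathbf L$ if $\Omega$ contains a domain (a nonempty connected open set) that contains an $n$-plane. Let $\Gamma$ be a torsion-free group of type $\mathbf L$, put $\Gamma^*=\Gamma\setminus\{1\}$, and suppose that the homogeneous coordinates are chosen so that for some $R>0$ the set $V_R=\{[z':z'']:\|z'\|>R\|z''\|\}$ is contained in $\Omega$ and satisfies $g(V_R)\cap V_R=\emptyset$ for all $g\in\Gamma^*$. For $g\in\Gamma$ choose a representative $\begin{pmatrix}A_g&B_g\\ C_g&D_g\end{pmatrix}\in\mathrm{SL}_{2n+2}(\mathbb C)$ with blocks in $M_{n+1}(\mathbb C)$ (the $C_g$, $g\in\Gamma^*$, are then invertible). Assume that the set $\mathcal R=\{\|C_g^{-1}\|: g\in\Gamma^*\}\subset\mathbb R$ satisfies * $(\clubsuit)$ $\mathcal R$ is bounded; * $(\spadesuit)$ $\mathcal R$ has no accumulation point in $\mathbb R$ other than $0$. Let $F$ be the interior of $\bigcap_{g\in\Gamma^*}\{[z':z'']:\|z''\|\le\|C_gz'+D_gz''\|\}$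 (the $F$-region), $\bar F$ its closure in $\mathbb P^{2n+1}$, and $\partial\bar F=\bar F\setminus F$. Then: 1. For $g\in\Gamma$, $g(F)\subset F$ holds if and only if $g=1$. 2. For $g\in\Gamma^*$, $g(F)\cap F=\emptyset$. 3. For every $z\in\Omega$ there is $g\in\Gamma$ with $g(z)\in\Omega\cap\bar F$. 4. If $z,w\in\Omega\cap\bar F$ and $w=g(z)$ for some $g\in\Gamma^*$, then both $z$ and $w$ lie in $\Omega\cap\partial\bar F$. -/

import Mathlib

open Topology Filter
open scoped LinearAlgebra.Projectivization MatrixGroups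

noncomputable section

namespace TypeL

/-- Coordinate indices of `ℂ^{2n+2}`: the left summand indexes `z' = (z⁰, …, zⁿ)`, the right summand
indexes `z'' = (zⁿ⁺¹, …, z²ⁿ⁺¹)`. -/
abbrev Idx (n : ℕ) : Type := Fin (n + 1) ⊕ Fin (n + 1)

/-- The projective space `ℙ^{2n+1}` of lines in `ℂ^{2n+2}`. -/
abbrev PSpace (n : ℕ) : Type := ℙ ℂ (Idx n → ℂ)

/-- The group `PGL_{2n+2}(ℂ)`; it acts on `PSpace n` by Mathlib's projective action. -/
abbrev PGrp (n : ℕ) : Type := Matrix.ProjGenLinGroup (Idx n) ℂ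

/-- The quotient topology on projective space. -/
instance (n : ℕ) : TopologicalSpace (PSpace n) :=
  TopologicalSpace.coinduced (Projectivization.mk' ℂ) inferInstance

/-- The quotient topology on `PGL_{2n+2}(ℂ)`. -/
instance (n : ℕ) : TopologicalSpace (PGrp n) :=
  TopologicalSpace.coinduced (Matrix.ProjGenLinGroup.mk : GL (Idx n) ℂ → PGrp n) inferInstance

/-! ### Linear subspaces, Plücker coordinates, compound matrices -/

/-- The `(n+1)`-element multi-indices `i₀ < … < iₙ` in the `2n+2` coordinate indices, where all
indices of `z'` precede those of `z''`. -/
abbrev MultiIdx (n : ℕ) : Type := Fin (n + 1) ↪o (Fin (n + 1) ⊕ₗ Fin (n + 1))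

/-- The position of the `k`-th entry of a multi-index. -/
def MultiIdx.at {n : ℕ} (K : MultiIdx n) (k : Fin (n + 1)) : Idx n := ofLex (K k)

/-- The matrix `Â` of all `(n+1) × (n+1)` minors of `A`, i.e. the action of `A` on `⋀^{n+1} ℂ^{2n+2}`
in the standard basis. -/
def compound {n : ℕ} (A : Matrix (Idx n) (Idx n) ℂ) : Matrix (MultiIdx n) (MultiIdx n) ℂ :=
  Matrix.of fun K J => (A.submatrix K.at J.at).det

/-- The vector of maximal minors of a `(2n+2) × (n+1)` matrix. -/
def plucker {n : ℕ} (X : Matrix (Idx n) (Fin (n + 1)) ℂ) : MultiIdx n → ℂ :=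
  fun K => (X.submatrix K.at id).det

/-- An `n`-plane of `ℙ^{2n+1}`, given as a linear subspace of `ℂ^{2n+2}` of dimension `n + 1`. -/
def IsPlane {n : ℕ} (L : Submodule ℂ (Idx n → ℂ)) : Prop := Module.finrank ℂ L = n + 1

/-- `p` is a vector of Plücker coordinates of the `n`-plane `L`. -/
def IsPluckerOf {n : ℕ} (p : MultiIdx n → ℂ) (L : Submodule ℂ (Idx n → ℂ)) : Prop :=
  ∃ X : Matrix (Idx n) (Fin (n + 1)) ℂ,
    LinearIndependent ℂ (fun j => X.col j) ∧
    Submodule.span ℂ (Set.range fun j => X.col j) = L ∧ p = plucker X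

/-- The support in `ℙ^{2n+1}` of a projective linear subspace. -/
def support {n : ℕ} (L : Submodule ℂ (Idx n → ℂ)) : Set (PSpace n) := {z | z.submodule ≤ L}

/-! ### Normal sequences, limit set, set of discontinuity, type L groups -/

/-- The largest modulus of an entry of `A` equals `1`. -/
def MaxEntryOne {ι : Type*} (A : Matrix ι ι ℂ) : Prop :=
  (∀ i j, ‖A i j‖ ≤ 1) ∧ ∃ i j, ‖A i j‖ = 1

/-- `A` is a matrix representative of `g ∈ PGL_{2n+2}(ℂ)`. -/
def IsRep {n : ℕ} (A : Matrix (Idx n) (Idx n) ℂ) (g : PGrp n) : Prop :=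
  ∃ a : GL (Idx n) ℂ, Matrix.ProjGenLinGroup.mk a = g ∧ (a : Matrix (Idx n) (Idx n) ℂ) = A

/-- `S` is a matrix representative of the transformation `ĝ` induced by `g` on the projective
space of `⋀^{n+1} ℂ^{2n+2}`. -/
def IsHatRep {n : ℕ} (S : Matrix (MultiIdx n) (MultiIdx n) ℂ) (g : PGrp n) : Prop :=
  ∃ A, IsRep A g ∧ ∃ c : ℂ, c ≠ 0 ∧ S = c • compound A

/-- `σ` is a normal sequence of `Γ` (a sequence of distinct elements such that both `σ` and the
induced sequence `σ̂` have convergent representatives of maximum norm one), and `S` is the limit of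
such representatives of `σ̂`. The limit image of `σ̂` is then the image of `S`. -/
structure IsNormalSeq {n : ℕ} (Γ : Subgroup (PGrp n)) (σ : ℕ → PGrp n)
    (S : Matrix (MultiIdx n) (MultiIdx n) ℂ) : Prop where
  mem : ∀ ν, σ ν ∈ Γ
  distinct : Function.Injective σ
  convergent : ∃ (T : ℕ → Matrix (Idx n) (Idx n) ℂ) (T₀ : Matrix (Idx n) (Idx n) ℂ),
    (∀ ν, IsRep (T ν) (σ ν) ∧ MaxEntryOne (T ν)) ∧ Tendsto T atTop (𝓝 T₀)
  hat_convergent : ∃ T : ℕ → Matrix (MultiIdx n) (MultiIdx n) ℂ,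
    (∀ ν, IsHatRep (T ν) (σ ν) ∧ MaxEntryOne (T ν)) ∧ Tendsto T atTop (𝓝 S)

/-- `L` is a limit `n`-plane of `Γ`: its Plücker point lies in the limit image of `σ̂` for some
normal sequence `σ` of `Γ`. -/
def IsLimitPlane {n : ℕ} (Γ : Subgroup (PGrp n)) (L : Submodule ℂ (Idx n → ℂ)) : Prop :=
  IsPlane L ∧ ∃ σ S, IsNormalSeq Γ σ S ∧ ∃ p, IsPluckerOf p L ∧ p ∈ LinearMap.range S.mulVecLin

/-- The limit set `Λ(Γ)`: the union of the limit `n`-planes. -/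
def limitSet {n : ℕ} (Γ : Subgroup (PGrp n)) : Set (PSpace n) :=
  ⋃ (L : Submodule ℂ (Idx n → ℂ)) (_ : IsLimitPlane Γ L), support L

/-- The set of discontinuity `Ω(Γ)`. -/
def Omega {n : ℕ} (Γ : Subgroup (PGrp n)) : Set (PSpace n) := (limitSet Γ)ᶜ

/-- A large domain: a connected nonempty open set that contains an `n`-plane. -/
def IsLargeDomain {n : ℕ} (U : Set (PSpace n)) : Prop :=
  IsOpen U ∧ IsConnected U ∧ ∃ L : Submodule ℂ (Idx n → ℂ), IsPlane L ∧ support L ⊆ U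

/-- A group of type L: a discrete subgroup of `PGL_{2n+2}(ℂ)` whose set of discontinuity contains a
large domain. -/
def IsTypeL {n : ℕ} (Γ : Subgroup (PGrp n)) : Prop :=
  DiscreteTopology Γ ∧ ∃ U, IsLargeDomain U ∧ U ⊆ Omega Γ

/-! ### The F-region -/

/-- The Euclidean norm on `ℂ^{n+1}`. -/
def enorm2 {n : ℕ} (u : Fin (n + 1) → ℂ) : ℝ := ‖WithLp.toLp 2 u‖

/-- The operator norm on `M_{n+1}(ℂ)` for the Euclidean norm. -/
def opNorm {n : ℕ} (A : Matrix (Fin (n + 1)) (Fin (n + 1)) ℂ) : ℝ :=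
  ‖Matrix.toEuclideanCLM (n := Fin (n + 1)) (𝕜 := ℂ) A‖

/-- The component `z'` of a vector. -/
def fstPart {n : ℕ} (v : Idx n → ℂ) : Fin (n + 1) → ℂ := fun i => v (Sum.inl i)

/-- The component `z''` of a vector. -/
def sndPart {n : ℕ} (v : Idx n → ℂ) : Fin (n + 1) → ℂ := fun i => v (Sum.inr i)

/-- `V_R = {[z' : z''] : ‖z'‖ > R ‖z''‖}`, a neighbourhood of the `n`-plane `z'' = 0`. -/
def tube {n : ℕ} (R : ℝ) : Set (PSpace n) :=
  {z | R * enorm2 (sndPart z.rep) < enorm2 (fstPart z.rep)}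

/-- The homogeneous coordinates are adapted to `Γ`: some `V_R` lies in `Ω(Γ)` and is disjoint from
all its translates by nontrivial elements of `Γ`. -/
def IsAdapted {n : ℕ} (Γ : Subgroup (PGrp n)) : Prop :=
  ∃ R : ℝ, 0 < R ∧ tube R ⊆ Omega Γ ∧
    ∀ g ∈ Γ, g ≠ 1 → ((fun z : PSpace n => g • z) '' tube R) ∩ tube R = ∅

theorem exists_slRep {n : ℕ} (g : PGrp n) :
    ∃ M : Matrix.SpecialLinearGroup (Idx n) ℂ, Matrix.SpecialLinearGroup.toPGL M = g := by
  have h : Function.Surjective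
      (Matrix.ProjectiveSpecialLinearGroup.toPGL (n := Idx n) (R := ℂ)) :=
    Matrix.ProjectiveSpecialLinearGroup.isoPSLOfAlgClosedOfNonempty.symm.surjective
  obtain ⟨x, hx⟩ := h g
  obtain ⟨M, rfl⟩ := QuotientGroup.mk_surjective x
  exact ⟨M, hx⟩

/-- A representative of `g` in `SL_{2n+2}(ℂ)`; it is unique up to a root of unity, which affects
none of the norms below. -/
def slRep {n : ℕ} (g : PGrp n) : Matrix.SpecialLinearGroup (Idx n) ℂ := (exists_slRep g).choose

theorem slRep_spec {n : ℕ} (g : PGrp n) : Matrix.SpecialLinearGroup.toPGL (slRep g) = g :=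
  (exists_slRep g).choose_spec

/-- The lower left block `C_g`. -/
def blockC {n : ℕ} (g : PGrp n) : Matrix (Fin (n + 1)) (Fin (n + 1)) ℂ :=
  (slRep g : Matrix (Idx n) (Idx n) ℂ).toBlocks₂₁

/-- The lower right block `D_g`. -/
def blockD {n : ℕ} (g : PGrp n) : Matrix (Fin (n + 1)) (Fin (n + 1)) ℂ :=
  (slRep g : Matrix (Idx n) (Idx n) ℂ).toBlocks₂₂

/-- The set `{[z' : z''] : ‖z''‖ ≤ ‖C_g z' + D_g z''‖}`. -/
def deltaBar {n : ℕ} (g : PGrp n) : Set (PSpace n) :=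
  {z | enorm2 (sndPart z.rep) ≤
    enorm2 ((blockC g).mulVec (fstPart z.rep) + (blockD g).mulVec (sndPart z.rep))}

/-- The F-region: the interior of the intersection of the sets `deltaBar g` over all nontrivial
`g ∈ Γ`. -/
def FRegion {n : ℕ} (Γ : Subgroup (PGrp n)) : Set (PSpace n) :=
  interior (⋂ (g : PGrp n) (_ : g ∈ Γ ∧ g ≠ 1), deltaBar g)

/-- The set of all `‖C_g⁻¹‖` for nontrivial `g ∈ Γ`. -/
def radii {n : ℕ} (Γ : Subgroup (PGrp n)) : Set ℝ :=
  {r | ∃ g ∈ Γ, g ≠ 1 ∧ r = opNorm (blockC g)⁻¹}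

/-- Condition (♣): the set of all `‖C_g⁻¹‖` is bounded. -/
def Club {n : ℕ} (Γ : Subgroup (PGrp n)) : Prop := Bornology.IsBounded (radii Γ)

/-- Condition (♠): the set of all `‖C_g⁻¹‖` has no accumulation point in `ℝ` other than `0`. -/
def Spade {n : ℕ} (Γ : Subgroup (PGrp n)) : Prop := ∀ x : ℝ, AccPt x (𝓟 (radii Γ)) → x = 0

end TypeL

end

/-! ### The Cauchy–Binet formula -/

namespace Matrix

variable {m : ℕ} {I R : Type*} [Fintype I] [CommRing R]

/-! The region is a Ford domain. For `SL`-lifts put N_g(v) = ‖C_g z' + D_g z''‖ (`movedNorm`), the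
norm of the second component of g v. Lifts differ by roots of unity, so N_{gh}(v) = N_g(h v) and
N_1(v) = ‖z''‖. Thus F is the interior of the set of points at which N_1 is minimal among all N_g,
and a translate of a point into the closure of F is found by minimizing N_g over Γ.

Disjointness (`TubeDisjoint.smul_FRegion_inter`): where F meets a translate, both minimality
conditions hold on an open set, so N_g = N_1 there. But N_g varies with z' because C_g is
invertible, and N_1 does not; the parallelogram law excludes equality on an open set.

Covering (`TubeDisjoint.exists_smul_mem_closure`): near a point of Ω only finitely many N_g compete
with N_1. Off the nowhere dense sets where two competitors agree, the minimum is strict on open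
cells, and the minimizing g maps its cell into F. Taking closures covers Ω.

Local finiteness (`TubeDisjoint.exists_finset_eventually_lt`) rests on z' + C_g⁻¹D_g z'' = C_g⁻¹(C_g
z' + D_g z''). The left side stays away from 0 for almost all g, because limits of the graphs z' =
-C_g⁻¹D_g z'' are limit n-planes (`TubeDisjoint.isLimitPlane_of_tendsto_slope`). It remains to see
that C_g⁻¹ → 0.

That decay (`TubeDisjoint.finite_opNorm_ge`) is the heart of the matter. Otherwise (♣) gives
distinct σ_ν with C⁻¹ → P ≠ 0 and convergent C⁻¹D. For each fixed h ≠ 1 the inverse of the C-block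
of σ_ν h again has a nonzero limit, so by (♠) its norm is eventually constant: these C-blocks share
a nonzero singular value, a polynomial condition on the entries of σ_ν and their conjugates. Take h
= σ_μ⁻¹. By Noetherianity finitely many μ imply all the conditions, so they hold simultaneously for
large ν, including μ = ν. There the C-block of the identity is 0, which has no nonzero singular
value. -/

theorem det_mul_eq_sum_funs (A : Matrix (Fin m) I R) (B : Matrix I (Fin m) R) :
    (A * B).det = ∑ p : Fin m → I, (∏ i, A i (p i)) * (B.submatrix p id).det := by
  classical
  have h : A * B = fun i => ∑ k, A i k • B k := by
    ext i j
    simp [mul_apply]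
  rw [h]
  refine (detRowAlternating.toMultilinearMap.map_sum fun i (k : I) => A i k • B k).trans ?_
  refine Finset.sum_congr rfl fun p _ => ?_
  exact detRowAlternating.toMultilinearMap.map_smul_univ (fun i => A i (p i)) (fun i => B (p i))

variable [LinearOrder I]

/-- The **Cauchy–Binet formula**. -/
theorem det_mul_eq_sum_orderEmbedding (A : Matrix (Fin m) I R) (B : Matrix I (Fin m) R) :
    (A * B).det =
      ∑ J : Fin m ↪o I, (A.submatrix id J).det * (B.submatrix J id).det := by
  classical
  have h1 : ∀ J : Fin m ↪o I, (A.submatrix id J).det * (B.submatrix J id).det =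
      ∑ σ : Equiv.Perm (Fin m),
        (∏ i, A i (J (σ i))) * (B.submatrix (fun i => J (σ i)) id).det := by
    intro J
    rw [← det_transpose (A.submatrix id J), det_apply', Finset.sum_mul]
    refine Finset.sum_congr rfl fun σ _ => ?_
    have h2 : (B.submatrix (fun i => J (σ i)) id).det =
        Equiv.Perm.sign σ * (B.submatrix J id).det := by
      rw [← det_permute]
      rfl
    rw [h2]
    simp only [transpose_apply, submatrix_apply, id]
    ring
  rw [det_mul_eq_sum_funs, Finset.sum_congr rfl fun J _ => h1 J, Finset.sum_sigma',
    Finset.univ_sigma_univ]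
  symm
  -- The pairs (J, σ) correspond to the injective maps J ∘ σ, with σ⁻¹ recovered by sorting; a
  -- non-injective map repeats a row of B and contributes 0.
  refine Finset.sum_of_injOn (fun x i => x.1 (x.2 i)) ?_ (by simp) ?_ (fun _ _ => rfl)
  · rintro ⟨J, σ⟩ - ⟨J', σ'⟩ - h
    have h' : ∀ i, J (σ i) = J' (σ' i) := fun i => congrFun h i
    have hJ : J = J' := by
      rw [← OrderEmbedding.range_inj]
      ext x
      constructor
      · rintro ⟨i, rfl⟩
        exact ⟨σ' (σ⁻¹ i), by rw [← h']; simp⟩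
      · rintro ⟨i, rfl⟩
        exact ⟨σ (σ'⁻¹ i), by rw [h']; simp⟩
    subst hJ
    obtain rfl : σ = σ' := Equiv.ext fun i => J.injective (h' i)
    rfl
  · intro p _ hp
    by_cases hinj : Function.Injective p
    · refine absurd ?_ hp
      have hs : StrictMono (p ∘ Tuple.sort p) :=
        (Tuple.monotone_sort p).strictMono_of_injective (hinj.comp (Tuple.sort p).injective)
      exact ⟨⟨OrderEmbedding.ofStrictMono _ hs, (Tuple.sort p)⁻¹⟩, by simp, by ext i; simp⟩
    · obtain ⟨i, j, hij, hne⟩ : ∃ i j, p i = p j ∧ i ≠ j := by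
        simpa [Function.Injective] using hinj
      rw [det_zero_of_row_eq hne (by ext k; simp [hij]), mul_zero]

end Matrix

/-! ### Multiplicativity of compound matrices and Plücker vectors -/

namespace TypeL

variable {n : ℕ}

theorem compound_mul (A B : Matrix (Idx n) (Idx n) ℂ) :
    compound (A * B) = compound A * compound B := by
  ext K J
  have := Matrix.det_mul_eq_sum_orderEmbedding
    (A.submatrix K.at (ofLex : Fin (n + 1) ⊕ₗ Fin (n + 1) → Idx n))
    (B.submatrix (ofLex : Fin (n + 1) ⊕ₗ Fin (n + 1) → Idx n) J.at)
  rw [Matrix.submatrix_mul_equiv (e₂ := (ofLex : Fin (n + 1) ⊕ₗ Fin (n + 1) ≃ Idx n))] at this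
  rw [Matrix.mul_apply]
  exact this

theorem plucker_mul (A : Matrix (Idx n) (Idx n) ℂ) (X : Matrix (Idx n) (Fin (n + 1)) ℂ) :
    plucker (A * X) = (compound A).mulVec (plucker X) := by
  ext K
  have := Matrix.det_mul_eq_sum_orderEmbedding
    (A.submatrix K.at (ofLex : Fin (n + 1) ⊕ₗ Fin (n + 1) → Idx n))
    (X.submatrix (ofLex : Fin (n + 1) ⊕ₗ Fin (n + 1) → Idx n) id)
  rw [Matrix.submatrix_mul_equiv (e₂ := (ofLex : Fin (n + 1) ⊕ₗ Fin (n + 1) ≃ Idx n))] at this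
  exact this

theorem MultiIdx.at_injective (K : MultiIdx n) : Function.Injective K.at :=
  ofLex.injective.comp K.injective

theorem compound_one : compound (1 : Matrix (Idx n) (Idx n) ℂ) = 1 := by
  classical
  ext K J
  by_cases h : K = J
  · subst h
    simp [compound, Matrix.submatrix_one _ K.at_injective]
  · rw [Matrix.one_apply_ne h]
    -- Distinct increasing multi-indices of equal length have non-nested ranges, so some row of the
    -- minor vanishes.
    by_cases hsub : Set.range K ⊆ Set.range J
    · refine absurd (OrderEmbedding.range_inj.1 (Set.eq_of_subset_of_ncard_le hsub ?_)) h
      rw [Set.ncard_range_of_injective K.injective, Set.ncard_range_of_injective J.injective]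
    · obtain ⟨_, ⟨i, rfl⟩, hi⟩ := Set.not_subset.1 hsub
      refine Matrix.det_eq_zero_of_row_eq_zero i fun j => ?_
      refine Matrix.one_apply_ne fun hij => hi ⟨j, ?_⟩
      exact ofLex.injective hij.symm

end TypeL

namespace TypeL

variable {n : ℕ}

/-! ### Representatives in `SL` -/

/-- The chosen `SL`-representative, as a matrix. -/
noncomputable def slMat (g : PGrp n) : Matrix (Idx n) (Idx n) ℂ :=
  (slRep g : Matrix (Idx n) (Idx n) ℂ)

theorem det_slMat (g : PGrp n) : (slMat g).det = 1 := (slRep g).2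

theorem isUnit_det_slMat (g : PGrp n) : IsUnit (slMat g).det := by simp [det_slMat]

theorem isRep_slMat (g : PGrp n) : IsRep (slMat g) g :=
  ⟨Matrix.SpecialLinearGroup.toGL (slRep g), slRep_spec g, rfl⟩

theorem IsRep.mul {A B : Matrix (Idx n) (Idx n) ℂ} {g h : PGrp n} (hA : IsRep A g)
    (hB : IsRep B h) : IsRep (A * B) (g * h) := by
  obtain ⟨a, rfl, rfl⟩ := hA
  obtain ⟨b, rfl, rfl⟩ := hB
  exact ⟨a * b, map_mul _ _ _, rfl⟩

theorem IsRep.smul {A : Matrix (Idx n) (Idx n) ℂ} {g : PGrp n} (hA : IsRep A g) {c : ℂ}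
    (hc : c ≠ 0) : IsRep (c • A) g := by
  obtain ⟨a, rfl, rfl⟩ := hA
  refine ⟨.scalar (Idx n) (Units.mk0 c hc) * a, by simp, ?_⟩
  ext i j
  simp [Matrix.smul_apply]

theorem IsRep.det_ne_zero {A : Matrix (Idx n) (Idx n) ℂ} {g : PGrp n} (hA : IsRep A g) :
    A.det ≠ 0 := by
  obtain ⟨a, rfl, rfl⟩ := hA
  exact ((Matrix.isUnit_iff_isUnit_det _).1 a.isUnit).ne_zero

theorem IsRep.eq_smul {A B : Matrix (Idx n) (Idx n) ℂ} {g : PGrp n} (hA : IsRep A g)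
    (hB : IsRep B g) : ∃ c : ℂ, A = c • B := by
  obtain ⟨a, ha, rfl⟩ := hA
  obtain ⟨b, hb, rfl⟩ := hB
  obtain ⟨u, hu⟩ := Matrix.ProjGenLinGroup.mk_eq_mk_iff.1 (hb.trans ha.symm)
  refine ⟨u, ?_⟩
  rw [← hu]
  ext i j
  simp [Matrix.smul_apply, mul_comm]

/-- Scaling by c multiplies the determinant by a positive power of c, so c is a root of unity. This
makes every norm below independent of the chosen lift. -/
theorem exists_eq_unit_smul {A : Matrix (Idx n) (Idx n) ℂ} {g : PGrp n} (hA : IsRep A g)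
    (hdet : A.det = 1) : ∃ ζ : ℂ, ‖ζ‖ = 1 ∧ slMat g = ζ • A := by
  obtain ⟨c, hc⟩ := (isRep_slMat g).eq_smul hA
  refine ⟨c, ?_, hc⟩
  have h := det_slMat g
  rw [hc, Matrix.det_smul, hdet, mul_one] at h
  exact Complex.norm_eq_one_of_pow_eq_one h Fintype.card_ne_zero

theorem slMat_mul (g h : PGrp n) :
    ∃ ζ : ℂ, ‖ζ‖ = 1 ∧ slMat (g * h) = ζ • (slMat g * slMat h) :=
  exists_eq_unit_smul ((isRep_slMat g).mul (isRep_slMat h)) (by simp [det_slMat])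

theorem slMat_one : ∃ ζ : ℂ, ‖ζ‖ = 1 ∧ slMat (1 : PGrp n) = ζ • 1 :=
  exists_eq_unit_smul ⟨1, map_one _, rfl⟩ (by simp)

theorem isRep_inv (g : PGrp n) : IsRep (slMat g)⁻¹ g⁻¹ := by
  refine ⟨(Matrix.SpecialLinearGroup.toGL (slRep g))⁻¹, ?_, ?_⟩
  · rw [map_inv]
    exact congrArg _ (slRep_spec g)
  · rw [Matrix.coe_units_inv]
    rfl

theorem slMat_inv (g : PGrp n) : ∃ ζ : ℂ, ‖ζ‖ = 1 ∧ slMat g⁻¹ = ζ • (slMat g)⁻¹ :=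
  exists_eq_unit_smul (isRep_inv g) (by simp [det_slMat])

theorem mulVec_ne_zero {A : Matrix (Idx n) (Idx n) ℂ} (hA : IsUnit A.det) {v : Idx n → ℂ}
    (hv : v ≠ 0) : A.mulVec v ≠ 0 := fun h =>
  hv (Matrix.mulVec_injective_iff_isUnit.2 ((Matrix.isUnit_iff_isUnit_det A).2 hA)
    (h.trans (Matrix.mulVec_zero A).symm))

theorem smul_mk_eq (g : PGrp n) {v : Idx n → ℂ} (hv : v ≠ 0) :
    g • Projectivization.mk ℂ v hv =
      Projectivization.mk ℂ ((slMat g).mulVec v) (mulVec_ne_zero (isUnit_det_slMat g) hv) := by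
  conv_lhs => rw [← slRep_spec g]
  rfl

/-! ### The topology of projective space -/

theorem isOpen_cone {W : Set (PSpace n)} (hW : IsOpen W) :
    IsOpen {v : Idx n → ℂ | ∃ hv : v ≠ 0, Projectivization.mk ℂ v hv ∈ W} := by
  have h : IsOpen (Projectivization.mk' ℂ ⁻¹' W : Set {v : Idx n → ℂ // v ≠ 0}) :=
    isOpen_coinduced.1 hW
  convert isOpen_ne.isOpenMap_subtype_val _ h using 1
  ext v
  simp [Projectivization.mk'_eq_mk]

theorem isOpen_of_isOpen_cone {W : Set (PSpace n)}
    (hW : IsOpen {v : Idx n → ℂ | ∃ hv : v ≠ 0, Projectivization.mk ℂ v hv ∈ W}) :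
    IsOpen W := by
  refine isOpen_coinduced.2 ?_
  convert hW.preimage continuous_subtype_val using 1
  ext ⟨v, hv⟩
  simp [Projectivization.mk'_eq_mk, hv]

theorem continuous_smul_PSpace (g : PGrp n) : Continuous fun z : PSpace n => g • z := by
  refine continuous_def.2 fun W hW => isOpen_of_isOpen_cone ?_
  have h : Continuous fun v : Idx n → ℂ => (slMat g).mulVec v :=
    continuous_const.matrix_mulVec continuous_id
  convert ((isOpen_cone hW).preimage h).inter (isOpen_ne (x := (0 : Idx n → ℂ))) using 1
  ext v
  constructor
  · rintro ⟨hv, h⟩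
    rw [Set.mem_preimage, smul_mk_eq g hv] at h
    exact ⟨⟨_, h⟩, hv⟩
  · rintro ⟨⟨h1, h2⟩, hv⟩
    exact ⟨hv, by rw [Set.mem_preimage, smul_mk_eq g hv]; exact h2⟩

theorem isOpen_image_smul (g : PGrp n) {W : Set (PSpace n)} (hW : IsOpen W) :
    IsOpen ((fun z : PSpace n => g • z) '' W) := by
  convert hW.preimage (continuous_smul_PSpace g⁻¹) using 1
  ext z
  simp [Set.mem_preimage, Set.mem_image, ← eq_inv_smul_iff]

/-! ### The norm of the second component -/

/-- The Euclidean norm of `z''` as a function on `ℂ^{2n+2}`. -/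
noncomputable def sndNorm (v : Idx n → ℂ) : ℝ := enorm2 (sndPart v)

theorem enorm2_smul (c : ℂ) (u : Fin (n + 1) → ℂ) : enorm2 (c • u) = ‖c‖ * enorm2 u := by
  simp [enorm2, norm_smul]

theorem enorm2_nonneg (u : Fin (n + 1) → ℂ) : 0 ≤ enorm2 u := norm_nonneg _

theorem enorm2_add_le (u w : Fin (n + 1) → ℂ) : enorm2 (u + w) ≤ enorm2 u + enorm2 w := by
  simpa [enorm2] using norm_add_le (WithLp.toLp 2 u) (WithLp.toLp 2 w)

theorem enorm2_sub_rev (u w : Fin (n + 1) → ℂ) : enorm2 (u - w) = enorm2 (w - u) := by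
  simpa [enorm2] using norm_sub_rev (WithLp.toLp 2 u) (WithLp.toLp 2 w)

theorem enorm2_eq_zero {u : Fin (n + 1) → ℂ} : enorm2 u = 0 ↔ u = 0 := by
  simp [enorm2]

theorem enorm2_zero : enorm2 (0 : Fin (n + 1) → ℂ) = 0 := enorm2_eq_zero.2 rfl

theorem continuous_enorm2 : Continuous (enorm2 (n := n)) :=
  (PiLp.continuous_toLp 2 _).norm

theorem continuous_fstPart : Continuous (fstPart (n := n)) :=
  continuous_pi fun _ => continuous_apply _

theorem continuous_sndPart : Continuous (sndPart (n := n)) :=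
  continuous_pi fun _ => continuous_apply _

theorem continuous_sndNorm : Continuous (sndNorm (n := n)) :=
  continuous_enorm2.comp continuous_sndPart

theorem sndNorm_smul (c : ℂ) (v : Idx n → ℂ) : sndNorm (c • v) = ‖c‖ * sndNorm v :=
  enorm2_smul c (sndPart v)

theorem enorm2_le_opNorm (A : Matrix (Fin (n + 1)) (Fin (n + 1)) ℂ) (u : Fin (n + 1) → ℂ) :
    enorm2 (A.mulVec u) ≤ opNorm A * enorm2 u := by
  have := (Matrix.toEuclideanCLM (n := Fin (n + 1)) (𝕜 := ℂ) A).le_opNorm (WithLp.toLp 2 u)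
  rwa [Matrix.toEuclideanCLM_toLp] at this

theorem opNorm_le_of_forall {A : Matrix (Fin (n + 1)) (Fin (n + 1)) ℂ} {R : ℝ} (hR : 0 ≤ R)
    (h : ∀ u, enorm2 (A.mulVec u) ≤ R * enorm2 u) : opNorm A ≤ R := by
  refine ContinuousLinearMap.opNorm_le_bound _ hR fun x => ?_
  have := h (WithLp.ofLp x)
  rwa [enorm2, ← Matrix.toEuclideanCLM_toLp] at this

/-- `‖C_g z' + D_g z''‖`, the norm of the second component after applying `g`. -/
noncomputable def movedNorm (g : PGrp n) (v : Idx n → ℂ) : ℝ := sndNorm ((slMat g).mulVec v)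

/-- The cocycle rule that turns comparisons of ‖z''‖ along an orbit into comparisons of the
functions `movedNorm g` at one point. -/
theorem movedNorm_mul (g h : PGrp n) (v : Idx n → ℂ) :
    movedNorm (g * h) v = movedNorm g ((slMat h).mulVec v) := by
  obtain ⟨ζ, hζ, h⟩ := slMat_mul g h
  rw [movedNorm, h, Matrix.smul_mulVec, sndNorm_smul, hζ, one_mul, ← Matrix.mulVec_mulVec]
  rfl

theorem movedNorm_one (v : Idx n → ℂ) : movedNorm (1 : PGrp n) v = sndNorm v := by
  obtain ⟨ζ, hζ, h⟩ := slMat_one (n := n)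
  rw [movedNorm, h, Matrix.smul_mulVec, sndNorm_smul, hζ, one_mul, Matrix.one_mulVec]

theorem movedNorm_smul (g : PGrp n) (c : ℂ) (v : Idx n → ℂ) :
    movedNorm g (c • v) = ‖c‖ * movedNorm g v := by
  rw [movedNorm, Matrix.mulVec_smul, sndNorm_smul]
  rfl

theorem continuous_movedNorm (g : PGrp n) : Continuous (movedNorm g) :=
  continuous_sndNorm.comp (continuous_const.matrix_mulVec continuous_id)

theorem sndPart_slMat_mulVec (g : PGrp n) (v : Idx n → ℂ) :
    sndPart ((slMat g).mulVec v) =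
      (blockC g).mulVec (fstPart v) + (blockD g).mulVec (sndPart v) := by
  ext i
  simp [sndPart, fstPart, slMat, blockC, blockD, Matrix.mulVec, dotProduct, Fintype.sum_sum_type,
    Matrix.toBlocks₂₁, Matrix.toBlocks₂₂]

theorem mk_mem_deltaBar {g : PGrp n} {v : Idx n → ℂ} (hv : v ≠ 0) :
    Projectivization.mk ℂ v hv ∈ deltaBar g ↔ sndNorm v ≤ movedNorm g v := by
  obtain ⟨a, ha⟩ := Projectivization.exists_smul_eq_mk_rep ℂ v hv
  have h0 : 0 < ‖(a : ℂ)‖ := norm_pos_iff.2 a.ne_zero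
  change sndNorm _ ≤ enorm2 _ ↔ _
  rw [← sndPart_slMat_mulVec, ← ha]
  change sndNorm ((a : ℂ) • v) ≤ movedNorm g ((a : ℂ) • v) ↔ _
  rw [sndNorm_smul, movedNorm_smul, mul_le_mul_iff_right₀ h0]

theorem mk_mem_tube {R : ℝ} {v : Idx n → ℂ} (hv : v ≠ 0) :
    Projectivization.mk ℂ v hv ∈ tube R ↔ R * sndNorm v < enorm2 (fstPart v) := by
  obtain ⟨a, ha⟩ := Projectivization.exists_smul_eq_mk_rep ℂ v hv
  have h0 : 0 < ‖(a : ℂ)‖ := norm_pos_iff.2 a.ne_zero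
  change R * sndNorm _ < enorm2 _ ↔ _
  rw [← ha]
  change R * sndNorm ((a : ℂ) • v) < enorm2 ((a : ℂ) • fstPart v) ↔ _
  rw [sndNorm_smul, enorm2_smul, mul_left_comm, mul_lt_mul_iff_right₀ h0]

end TypeL

namespace TypeL

variable {n : ℕ}

/-! ### Blocks of the elements of an adapted group -/

/-- The upper left block `A_g`. -/
noncomputable def blockA (g : PGrp n) : Matrix (Fin (n + 1)) (Fin (n + 1)) ℂ :=
  (slMat g).toBlocks₁₁

/-- The upper right block `B_g`. -/
noncomputable def blockB (g : PGrp n) : Matrix (Fin (n + 1)) (Fin (n + 1)) ℂ :=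
  (slMat g).toBlocks₁₂

/-- The matrix `A_g C_g⁻¹`, whose graph is the image under `g` of the `n`-plane `z'' = 0`. -/
noncomputable def slope (g : PGrp n) : Matrix (Fin (n + 1)) (Fin (n + 1)) ℂ :=
  blockA g * (blockC g)⁻¹

/-- The matrix `C_g⁻¹ D_g`; the graph of its negative is the preimage under `g` of the `n`-plane
`z'' = 0`. -/
noncomputable def coslope (g : PGrp n) : Matrix (Fin (n + 1)) (Fin (n + 1)) ℂ :=
  (blockC g)⁻¹ * blockD g

theorem slMat_eq_fromBlocks (g : PGrp n) :
    slMat g = Matrix.fromBlocks (blockA g) (blockB g) (blockC g) (blockD g) :=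
  (Matrix.fromBlocks_toBlocks (slMat g)).symm

theorem slMat_mulVec (g : PGrp n) (u w : Fin (n + 1) → ℂ) :
    (slMat g).mulVec (Sum.elim u w) =
      Sum.elim ((blockA g).mulVec u + (blockB g).mulVec w)
        ((blockC g).mulVec u + (blockD g).mulVec w) := by
  rw [slMat_eq_fromBlocks, Matrix.fromBlocks_mulVec]
  rfl

theorem elim_fstPart_sndPart (v : Idx n → ℂ) : Sum.elim (fstPart v) (sndPart v) = v := by
  ext (i | i) <;> rfl

theorem sndPart_elim (u w : Fin (n + 1) → ℂ) : sndPart (Sum.elim u w : Idx n → ℂ) = w := rfl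

theorem fstPart_elim (u w : Fin (n + 1) → ℂ) : fstPart (Sum.elim u w : Idx n → ℂ) = u := rfl

theorem sndPart_smul (c : ℂ) (v : Idx n → ℂ) : sndPart (c • v) = c • sndPart v := rfl

theorem eq_zero_of_parts {v : Idx n → ℂ} (h1 : fstPart v = 0) (h2 : sndPart v = 0) : v = 0 := by
  rw [← elim_fstPart_sndPart v, h1, h2]
  ext (i | i) <;> rfl

theorem slMat_inv_mulVec_mulVec (g : PGrp n) (v : Idx n → ℂ) :
    ((slMat g)⁻¹).mulVec ((slMat g).mulVec v) = v := by
  rw [Matrix.mulVec_mulVec, Matrix.nonsing_inv_mul _ (isUnit_det_slMat g), Matrix.one_mulVec]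

theorem slMat_mulVec_inv_mulVec (g : PGrp n) (v : Idx n → ℂ) :
    (slMat g).mulVec (((slMat g)⁻¹).mulVec v) = v := by
  rw [Matrix.mulVec_mulVec, Matrix.mul_nonsing_inv _ (isUnit_det_slMat g), Matrix.one_mulVec]

theorem eq_zero_of_slMat_mulVec_eq_zero {g : PGrp n} {v : Idx n → ℂ}
    (h : (slMat g).mulVec v = 0) : v = 0 := by
  rw [← slMat_inv_mulVec_mulVec g v, h, Matrix.mulVec_zero]

/-- The tube `V_R` is disjoint from its translates by the nontrivial elements of `Γ`. -/
def TubeDisjoint (Γ : Subgroup (PGrp n)) (R : ℝ) : Prop :=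
  ∀ g ∈ Γ, g ≠ 1 → ((fun z : PSpace n => g • z) '' tube R) ∩ tube R = ∅

variable {Γ : Subgroup (PGrp n)} {R : ℝ} {g h : PGrp n}

theorem TubeDisjoint.fst_le (hΓ : TubeDisjoint Γ R) (hg : g ∈ Γ) (h1 : g ≠ 1) {v : Idx n → ℂ}
    (hv : R * sndNorm v < enorm2 (fstPart v)) :
    enorm2 (fstPart ((slMat g).mulVec v)) ≤ R * movedNorm g v := by
  have hv0 : v ≠ 0 := by
    rintro rfl
    have h1 : sndPart (0 : Idx n → ℂ) = 0 := rfl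
    have h2 : fstPart (0 : Idx n → ℂ) = 0 := rfl
    simp [sndNorm, h1, h2, enorm2_zero] at hv
  by_contra! hlt
  have hmem : g • Projectivization.mk ℂ v hv0 ∈
      ((fun z : PSpace n => g • z) '' tube R) ∩ tube R :=
    ⟨⟨_, (mk_mem_tube hv0).2 hv, rfl⟩, by
      rw [smul_mk_eq]
      exact (mk_mem_tube _).2 hlt⟩
  rw [hΓ g hg h1] at hmem
  exact hmem

/-- A nonzero vector with z'' = 0 lies in the tube, so g⁻¹ carries it outside the tube. -/
theorem TubeDisjoint.fst_le_of_sndPart_eq_zero (hΓ : TubeDisjoint Γ R) (hg : g ∈ Γ) (h1 : g ≠ 1)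
    {v : Idx n → ℂ} (hv : sndPart ((slMat g).mulVec v) = 0) :
    enorm2 (fstPart v) ≤ R * sndNorm v := by
  by_cases hv0 : fstPart ((slMat g).mulVec v) = 0
  · rw [eq_zero_of_slMat_mulVec_eq_zero (eq_zero_of_parts hv0 hv)]
    have h1 : sndPart (0 : Idx n → ℂ) = 0 := rfl
    have h2 : fstPart (0 : Idx n → ℂ) = 0 := rfl
    simp [sndNorm, h1, h2, enorm2_zero]
  have hlt : R * sndNorm ((slMat g).mulVec v) < enorm2 (fstPart ((slMat g).mulVec v)) := by
    rw [sndNorm, hv, enorm2_zero, mul_zero]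
    exact (enorm2_nonneg _).lt_of_ne' fun h => hv0 (enorm2_eq_zero.1 h)
  have := hΓ.fst_le (Γ.inv_mem hg) (inv_ne_one.2 h1) hlt
  obtain ⟨ζ, hζ, hinv⟩ := slMat_inv g
  rw [movedNorm, hinv, Matrix.smul_mulVec, slMat_inv_mulVec_mulVec, sndNorm_smul] at this
  change enorm2 (ζ • fstPart v) ≤ _ at this
  rwa [enorm2_smul, hζ, one_mul, one_mul] at this

/-- A kernel vector u of C_g would give (u, 0) and its image both on the plane z'' = 0, hence both
in the tube. -/
theorem TubeDisjoint.isUnit_det_blockC (hΓ : TubeDisjoint Γ R) (hg : g ∈ Γ) (h1 : g ≠ 1) :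
    IsUnit (blockC g).det := by
  rw [isUnit_iff_ne_zero]
  intro hdet
  obtain ⟨u, hu, hCu⟩ := Matrix.exists_mulVec_eq_zero_iff.2 hdet
  have := hΓ.fst_le_of_sndPart_eq_zero hg h1 (v := Sum.elim u 0) (by
    rw [slMat_mulVec, sndPart_elim, hCu, Matrix.mulVec_zero, add_zero])
  rw [sndNorm, sndPart_elim, fstPart_elim, enorm2_zero, mul_zero] at this
  exact hu (enorm2_eq_zero.1 (this.antisymm (enorm2_nonneg u)))

theorem TubeDisjoint.slMat_mulVec_blockC_inv (hΓ : TubeDisjoint Γ R) (hg : g ∈ Γ) (h1 : g ≠ 1)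
    (y : Fin (n + 1) → ℂ) :
    (slMat g).mulVec (Sum.elim ((blockC g)⁻¹.mulVec y) 0) = Sum.elim ((slope g).mulVec y) y := by
  have hC := hΓ.isUnit_det_blockC hg h1
  rw [slMat_mulVec, Matrix.mulVec_mulVec, Matrix.mulVec_mulVec, Matrix.mul_nonsing_inv _ hC,
    Matrix.mulVec_zero, Matrix.mulVec_zero, add_zero, add_zero, Matrix.one_mulVec]
  rfl

theorem TubeDisjoint.sndPart_slMat_mulVec_coslope (hΓ : TubeDisjoint Γ R) (hg : g ∈ Γ)
    (h1 : g ≠ 1) (y : Fin (n + 1) → ℂ) :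
    sndPart ((slMat g).mulVec (Sum.elim (-(coslope g).mulVec y) y)) = 0 := by
  have hC := hΓ.isUnit_det_blockC hg h1
  rw [slMat_mulVec, sndPart_elim, Matrix.mulVec_neg, Matrix.mulVec_mulVec, coslope,
    Matrix.mul_nonsing_inv_cancel_left _ _ hC, neg_add_cancel]

theorem TubeDisjoint.enorm2_coslope_le (hΓ : TubeDisjoint Γ R) (hg : g ∈ Γ) (h1 : g ≠ 1)
    (y : Fin (n + 1) → ℂ) : enorm2 ((coslope g).mulVec y) ≤ R * enorm2 y := by
  have := hΓ.fst_le_of_sndPart_eq_zero hg h1 (hΓ.sndPart_slMat_mulVec_coslope hg h1 y)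
  rw [fstPart_elim, sndNorm, sndPart_elim] at this
  have h2 := enorm2_smul (-1) ((coslope g).mulVec y)
  rw [neg_one_smul, norm_neg, norm_one, one_mul] at h2
  rwa [h2] at this

/-- The left side measures how far v is from the plane that g sends to z'' = 0; with ‖C_g⁻¹‖ small,
this gap forces `movedNorm g v` to be large. -/
theorem TubeDisjoint.fst_add_coslope (hΓ : TubeDisjoint Γ R) (hg : g ∈ Γ) (h1 : g ≠ 1)
    (v : Idx n → ℂ) :
    fstPart v + (coslope g).mulVec (sndPart v) =
      (blockC g)⁻¹.mulVec (sndPart ((slMat g).mulVec v)) := by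
  have hC := hΓ.isUnit_det_blockC hg h1
  rw [sndPart_slMat_mulVec, Matrix.mulVec_add, Matrix.mulVec_mulVec, Matrix.mulVec_mulVec,
    Matrix.nonsing_inv_mul _ hC, Matrix.one_mulVec]
  rfl

theorem TubeDisjoint.enorm2_fst_add_coslope_le (hΓ : TubeDisjoint Γ R) (hg : g ∈ Γ) (h1 : g ≠ 1)
    (v : Idx n → ℂ) :
    enorm2 (fstPart v + (coslope g).mulVec (sndPart v)) ≤
      opNorm (blockC g)⁻¹ * movedNorm g v := by
  rw [hΓ.fst_add_coslope hg h1]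
  exact enorm2_le_opNorm _ _

/-- Factoring C_g A_h + D_g C_h this way lets the inverse of the product's block converge along with
C_g⁻¹ and `coslope g`, even if C_g itself is unbounded. -/
theorem TubeDisjoint.toBlocks₂₁_mul (hΓ : TubeDisjoint Γ R) (hg : g ∈ Γ) (h1 : g ≠ 1)
    (hh : h ∈ Γ) (hh1 : h ≠ 1) :
    (slMat g * slMat h).toBlocks₂₁ = blockC g * (slope h + coslope g) * blockC h := by
  have hC := hΓ.isUnit_det_blockC hg h1
  have hC' := hΓ.isUnit_det_blockC hh hh1
  rw [slMat_eq_fromBlocks g, slMat_eq_fromBlocks h, Matrix.fromBlocks_multiply,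
    Matrix.toBlocks_fromBlocks₂₁, mul_add, add_mul, slope, coslope, Matrix.mul_assoc,
    Matrix.mul_assoc, Matrix.nonsing_inv_mul _ hC', Matrix.mul_one,
    Matrix.mul_nonsing_inv_cancel_left _ _ hC]

/-- A kernel vector y puts the point h(C_h⁻¹y, 0) on the limit of the planes sent by σ_k to z'' = 0.
Pulled back by h, these planes are sent there by σ_k h, so they satisfy ‖z'‖ ≤ R‖z''‖; in the limit
so does (C_h⁻¹y, 0), whence y = 0. -/
theorem TubeDisjoint.isUnit_slope_add_limit (hΓ : TubeDisjoint Γ R) {σ : ℕ → PGrp n}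
    (hσ : ∀ k, σ k ∈ Γ ∧ σ k ≠ 1) (hinj : Function.Injective σ)
    {G : Matrix (Fin (n + 1)) (Fin (n + 1)) ℂ} (hG : Tendsto (fun k => coslope (σ k)) atTop (𝓝 G))
    (hh : h ∈ Γ) (hh1 : h ≠ 1) : IsUnit (slope h + G).det := by
  rw [isUnit_iff_ne_zero]
  intro hdet
  obtain ⟨y, hy, hGy⟩ := Matrix.exists_mulVec_eq_zero_iff.2 hdet
  have hGy' : -G.mulVec y = (slope h).mulVec y := by
    rw [Matrix.add_mulVec] at hGy
    exact (eq_neg_of_add_eq_zero_left hGy).symm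
  have hev : ∀ᶠ k in atTop, σ k * h ≠ 1 := by
    have := hinj.tendsto_cofinite.eventually (Set.finite_singleton h⁻¹).eventually_cofinite_notMem
    rw [Nat.cofinite_eq_atTop] at this
    filter_upwards [this] with k hk hk'
    exact hk (eq_inv_of_mul_eq_one_left hk')
  have hcont : Continuous fun X : Matrix (Fin (n + 1)) (Fin (n + 1)) ℂ =>
      ((slMat h)⁻¹).mulVec (Sum.elim (-X.mulVec y) y) := by
    refine continuous_const.matrix_mulVec (continuous_pi ?_)
    rintro (i | i)
    · exact (continuous_apply i).comp (continuous_id.matrix_mulVec continuous_const).neg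
    · exact continuous_const
  have hle : ∀ᶠ k in atTop,
      enorm2 (fstPart (((slMat h)⁻¹).mulVec (Sum.elim (-(coslope (σ k)).mulVec y) y))) ≤
        R * sndNorm (((slMat h)⁻¹).mulVec (Sum.elim (-(coslope (σ k)).mulVec y) y)) := by
    filter_upwards [hev] with k hk
    refine hΓ.fst_le_of_sndPart_eq_zero (Γ.mul_mem (hσ k).1 hh) hk ?_
    obtain ⟨ζ, -, hζ⟩ := slMat_mul (σ k) h
    rw [hζ, Matrix.smul_mulVec, ← Matrix.mulVec_mulVec, slMat_mulVec_inv_mulVec]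
    rw [sndPart_smul, hΓ.sndPart_slMat_mulVec_coslope (hσ k).1 (hσ k).2, smul_zero]
  have hlim := le_of_tendsto_of_tendsto
    (((continuous_enorm2.comp continuous_fstPart).comp hcont).continuousAt.tendsto.comp hG)
    (((continuous_sndNorm.comp hcont).continuousAt.tendsto.comp hG).const_mul R) hle
  change enorm2 (fstPart (((slMat h)⁻¹).mulVec (Sum.elim (-G.mulVec y) y))) ≤
    R * sndNorm (((slMat h)⁻¹).mulVec (Sum.elim (-G.mulVec y) y)) at hlim
  rw [hGy', ← hΓ.slMat_mulVec_blockC_inv hh hh1, slMat_inv_mulVec_mulVec, sndNorm, fstPart_elim,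
    sndPart_elim, enorm2_zero, mul_zero] at hlim
  have h0 := congrArg ((blockC h).mulVec) (enorm2_eq_zero.1 (hlim.antisymm (enorm2_nonneg _)))
  rw [Matrix.mulVec_mulVec, Matrix.mul_nonsing_inv _ (hΓ.isUnit_det_blockC hh hh1),
    Matrix.one_mulVec, Matrix.mulVec_zero] at h0
  exact hy h0

end TypeL

namespace TypeL

variable {n : ℕ}

/-! ### Compactness and continuity for matrices -/

theorem isCompact_entries_le {ι κ : Type*} (K : ℝ) :
    IsCompact {A : Matrix ι κ ℂ | ∀ i j, ‖A i j‖ ≤ K} := by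
  have h : IsCompact (Set.univ.pi fun _ : ι => Set.univ.pi fun _ : κ => Metric.closedBall (0 : ℂ) K) :=
    isCompact_univ_pi fun _ => isCompact_univ_pi fun _ => isCompact_closedBall _ _
  change IsCompact {A : ι → κ → ℂ | ∀ i j, ‖A i j‖ ≤ K}
  convert h using 1
  ext A
  simp [Set.mem_pi]

instance {ι κ : Type*} [Countable ι] [Countable κ] : FirstCountableTopology (Matrix ι κ ℂ) :=
  inferInstanceAs (FirstCountableTopology (ι → κ → ℂ))

theorem norm_apply_le_opNorm (A : Matrix (Fin (n + 1)) (Fin (n + 1)) ℂ) (i j : Fin (n + 1)) :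
    ‖A i j‖ ≤ opNorm A := by
  have h1 := enorm2_le_opNorm A (Pi.single j 1)
  have h2 : enorm2 (Pi.single j (1 : ℂ)) = 1 := by
    change ‖EuclideanSpace.single j (1 : ℂ)‖ = 1
    simp
  have h3 := PiLp.norm_apply_le (WithLp.toLp 2 (A.mulVec (Pi.single j 1))) i
  rw [Matrix.mulVec_single_one] at h1 h3
  rw [h2, mul_one] at h1
  exact h3.trans h1

theorem exists_subseq_tendsto_of_opNorm_le
    {x : ℕ → Matrix (Fin (n + 1)) (Fin (n + 1)) ℂ} {K : ℝ} (hx : ∀ k, opNorm (x k) ≤ K) :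
    ∃ A, ∃ φ : ℕ → ℕ, StrictMono φ ∧ Tendsto (x ∘ φ) atTop (𝓝 A) := by
  obtain ⟨A, -, φ, hφ, h⟩ := (isCompact_entries_le K).tendsto_subseq
    fun k i j => (norm_apply_le_opNorm (x k) i j).trans (hx k)
  exact ⟨A, φ, hφ, h⟩

theorem continuous_opNorm : Continuous (opNorm (n := n)) :=
  (LinearMap.continuous_of_finiteDimensional
    (Matrix.toEuclideanCLM (n := Fin (n + 1)) (𝕜 := ℂ)).toAlgEquiv.toLinearMap).norm

theorem opNorm_eq_zero {A : Matrix (Fin (n + 1)) (Fin (n + 1)) ℂ} : opNorm A = 0 ↔ A = 0 := by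
  rw [opNorm, norm_eq_zero, map_eq_zero_iff (Matrix.toEuclideanCLM (n := Fin (n + 1)) (𝕜 := ℂ))
    (EquivLike.injective _)]

theorem opNorm_smul (c : ℂ) (A : Matrix (Fin (n + 1)) (Fin (n + 1)) ℂ) :
    opNorm (c • A) = ‖c‖ * opNorm A := by
  rw [opNorm, map_smul, norm_smul]
  rfl

theorem continuousAt_matrix_inv {m : Type*} [Fintype m] [DecidableEq m] {A : Matrix m m ℂ}
    (hA : IsUnit A.det) :
    ContinuousAt (fun X : Matrix m m ℂ => X⁻¹) A := by
  simp only [Matrix.inv_def, Ring.inverse_eq_inv']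
  exact (continuous_id.matrix_det.continuousAt.inv₀ hA.ne_zero).smul
    continuous_id.matrix_adjugate.continuousAt

open scoped Matrix.Norms.L2Operator MatrixOrder ComplexOrder in
/-- The norm of the inverse of an invertible matrix is the inverse of a singular value. -/
theorem det_conjTranspose_mul_self_sub_eq_zero {X : Matrix (Fin (n + 1)) (Fin (n + 1)) ℂ}
    (hX : IsUnit X.det) :
    (X.conjTranspose * X - ((opNorm X⁻¹ ^ 2)⁻¹ : ℂ) • 1).det = 0 := by
  set P := X⁻¹ with hP
  have hPX : P * X = 1 := Matrix.nonsing_inv_mul _ hX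
  have hXP : X * P = 1 := Matrix.mul_nonsing_inv _ hX
  have hP0 : opNorm P ≠ 0 := by
    rw [Ne, opNorm_eq_zero]
    intro h
    rw [h, zero_mul] at hPX
    exact zero_ne_one hPX
  -- By the C*-identity ‖PP*‖ = ‖P‖², and the norm of a positive element lies in its spectrum. As
  -- PP* is the inverse of X*X, this makes ‖P‖⁻² an eigenvalue of X*X.
  have hmem := CStarAlgebra.norm_mem_spectrum_of_nonneg (a := P * P.conjTranspose)
    (Matrix.posSemidef_self_mul_conjTranspose P).nonneg
  have hnorm : ‖P * P.conjTranspose‖ = opNorm P ^ 2 := by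
    have := CStarRing.norm_self_mul_star (x := P)
    rw [sq]
    exact this
  rw [hnorm] at hmem
  by_contra hne
  apply hmem
  change IsUnit (algebraMap ℝ (Matrix (Fin (n + 1)) (Fin (n + 1)) ℂ) (opNorm P ^ 2) -
      P * P.conjTranspose)
  have hfac : algebraMap ℝ (Matrix (Fin (n + 1)) (Fin (n + 1)) ℂ) (opNorm P ^ 2) -
      P * P.conjTranspose = ((opNorm P : ℂ) ^ 2) • (P * P.conjTranspose *
        (X.conjTranspose * X - ((opNorm P ^ 2)⁻¹ : ℂ) • 1)) := by
    have h1 : P * P.conjTranspose * (X.conjTranspose * X) = 1 := by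
      rw [Matrix.mul_assoc, ← Matrix.mul_assoc P.conjTranspose, ← Matrix.conjTranspose_mul, hXP,
        Matrix.conjTranspose_one, Matrix.one_mul, hPX]
    rw [mul_sub, h1, mul_smul_comm, mul_one, smul_sub, smul_smul, mul_inv_cancel₀, one_smul]
    · congr 1
      rw [Algebra.algebraMap_eq_smul_one]
      ext i j
      simp [Matrix.smul_apply]
    · exact pow_ne_zero 2 (by exact_mod_cast hP0)
  rw [hfac, Matrix.isUnit_iff_isUnit_det, Matrix.det_smul, Matrix.det_mul, Matrix.det_mul,
    Matrix.det_conjTranspose]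
  have hdetP : P.det ≠ 0 := (Matrix.isUnit_nonsing_inv_det _ hX).ne_zero
  refine isUnit_iff_ne_zero.2 (mul_ne_zero (pow_ne_zero _ (pow_ne_zero 2 (by exact_mod_cast hP0)))
    (mul_ne_zero (mul_ne_zero hdetP (star_ne_zero.2 hdetP)) hne))

/-! ### A consequence of the Hilbert basis theorem -/

/-- The ideal of all q μ is generated by finitely many of them, and finitely many eventual
conditions hold simultaneously. The gain is that the threshold for ν no longer depends on μ. -/
theorem eventually_forall_eval_eq_zero {τ : Type*} [Finite τ] (q : ℕ → MvPolynomial τ ℂ)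
    (x : ℕ → τ → ℂ) (h : ∀ μ, ∀ᶠ ν in atTop, MvPolynomial.eval (x ν) (q μ) = 0) :
    ∀ᶠ ν in atTop, ∀ μ, MvPolynomial.eval (x ν) (q μ) = 0 := by
  obtain ⟨s, hs, hspan⟩ := (Submodule.fg_span_iff_fg_span_finset_subset (Set.range q)).1
    (IsNoetherian.noetherian (Ideal.span (Set.range q)))
  have h' : ∀ᶠ ν in atTop, ∀ p ∈ s, MvPolynomial.eval (x ν) p = 0 := by
    rw [Filter.eventually_all_finset]
    intro p hp
    obtain ⟨μ, rfl⟩ := hs hp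
    exact h μ
  filter_upwards [h'] with ν hν μ
  have hle : Ideal.span (s : Set (MvPolynomial τ ℂ)) ≤ RingHom.ker (MvPolynomial.eval (x ν)) :=
    Ideal.span_le.2 fun p hp => hν p hp
  have hmem : q μ ∈ Ideal.span (s : Set (MvPolynomial τ ℂ)) := by
    rw [Ideal.span, ← hspan]
    exact Submodule.subset_span ⟨μ, rfl⟩
  exact hle hmem

/-- Let `c ν μ` be a block of `Y ν * (Y μ)⁻¹`, so that `c ν ν = 0`. It is impossible that for every
`μ` the matrices `c ν μ` have a common nonzero singular value for all large `ν`. -/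
theorem false_of_common_singular_values (Y N : ℕ → Matrix (Idx n) (Idx n) ℂ)
    (hYN : ∀ k, Y k * N k = 1) (t : ℕ → ℂ) (ht : ∀ k, t k ≠ 0)
    (h : ∀ μ, ∀ᶠ ν in atTop,
      ((Y ν * N μ).toBlocks₂₁.conjTranspose * (Y ν * N μ).toBlocks₂₁ - t μ • 1).det = 0) :
    False := by
  -- One variable for each entry and one for its conjugate, so that the singular value condition
  -- becomes polynomial.
  let τ := (Idx n × Idx n) ⊕ (Idx n × Idx n)
  let a : Matrix (Idx n) (Idx n) (MvPolynomial τ ℂ) :=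
    Matrix.of fun i j => MvPolynomial.X (Sum.inl (i, j))
  let b : Matrix (Idx n) (Idx n) (MvPolynomial τ ℂ) :=
    Matrix.of fun i j => MvPolynomial.X (Sum.inr (i, j))
  let q : ℕ → MvPolynomial τ ℂ := fun μ =>
    ((b * ((N μ).map star).map MvPolynomial.C).toBlocks₂₁.transpose *
      (a * (N μ).map MvPolynomial.C).toBlocks₂₁ - (MvPolynomial.C (t μ) : MvPolynomial τ ℂ) • 1).det
  let x : ℕ → τ → ℂ := fun ν =>
    Sum.elim (fun p => Y ν p.1 p.2) (fun p => star (Y ν p.1 p.2))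
  have heval : ∀ ν μ, MvPolynomial.eval (x ν) (q μ) =
      ((Y ν * N μ).toBlocks₂₁.conjTranspose * (Y ν * N μ).toBlocks₂₁ - t μ • 1).det := by
    intro ν μ
    rw [RingHom.map_det]
    congr 1
    ext i j
    simp [a, b, x, Matrix.mul_apply, Matrix.toBlocks₂₁, Matrix.one_apply, Matrix.smul_apply]
    split_ifs <;> simp
  obtain ⟨k, hk⟩ := (eventually_forall_eval_eq_zero q x (by simpa only [heval] using h)).exists
  -- The diagonal case, where the product of the two matrices is the identity and its lower left
  -- block is 0.
  have := hk k
  rw [heval, hYN] at this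
  have h0 : (1 : Matrix (Idx n) (Idx n) ℂ).toBlocks₂₁ = 0 := by
    ext i j
    simp [Matrix.toBlocks₂₁]
  rw [h0, Matrix.mul_zero, zero_sub, ← neg_smul, Matrix.det_smul, Matrix.det_one, mul_one] at this
  exact ht k (neg_eq_zero.1 (pow_eq_zero_iff (by simp) |>.1 this))

/-! ### The norms `‖C_g⁻¹‖` tend to zero -/

variable {Γ : Subgroup (PGrp n)} {R : ℝ}

theorem TubeDisjoint.opNorm_coslope_le (hΓ : TubeDisjoint Γ R) (hR : 0 ≤ R) {g : PGrp n}
    (hg : g ∈ Γ) (h1 : g ≠ 1) : opNorm (coslope g) ≤ R :=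
  opNorm_le_of_forall hR (hΓ.enorm2_coslope_le hg h1)

/-- A nonzero limit of radii is not an accumulation point, so it can only be reached by being
eventually attained. -/
theorem Spade.eventually_eq (h : Spade Γ) {r : ℕ → ℝ} {ρ : ℝ} (hρ : ρ ≠ 0)
    (hr : ∀ᶠ k in atTop, r k ∈ radii Γ) (hlim : Tendsto r atTop (𝓝 ρ)) :
    ∀ᶠ k in atTop, r k = ρ := by
  have hacc : ¬ AccPt ρ (𝓟 (radii Γ)) := fun hacc => hρ (h ρ hacc)
  rw [accPt_iff_frequently, not_frequently] at hacc
  filter_upwards [hr, hlim.eventually hacc] with k hk hk'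
  by_contra hne
  exact hk' ⟨hne, hk⟩

/-- For `g_ν → ∞` in `Γ`, if `C_{g_ν}⁻¹` has a nonzero limit, then for every `h ∈ Γ` the matrices
`C_{g_ν h}` have a common nonzero singular value for all large `ν`. -/
theorem TubeDisjoint.exists_common_singular_value (hΓ : TubeDisjoint Γ R) (hspade : Spade Γ)
    {σ : ℕ → PGrp n} (hσ : ∀ k, σ k ∈ Γ ∧ σ k ≠ 1) (hinj : Function.Injective σ)
    {G P : Matrix (Fin (n + 1)) (Fin (n + 1)) ℂ}
    (hG : Tendsto (fun k => coslope (σ k)) atTop (𝓝 G))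
    (hP : Tendsto (fun k => (blockC (σ k))⁻¹) atTop (𝓝 P)) (hP0 : P ≠ 0)
    {h : PGrp n} (hh : h ∈ Γ) (hh1 : h ≠ 1) :
    ∃ t : ℂ, t ≠ 0 ∧ ∀ᶠ k in atTop, ((slMat (σ k) * slMat h).toBlocks₂₁.conjTranspose *
      (slMat (σ k) * slMat h).toBlocks₂₁ - t • 1).det = 0 := by
  have hunit := hΓ.isUnit_slope_add_limit hσ hinj hG hh hh1
  have hCh := hΓ.isUnit_det_blockC hh hh1
  set Q := (blockC h)⁻¹ * ((slope h + G)⁻¹ * P) with hQ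
  have hlim : Tendsto (fun k => (blockC h)⁻¹ * ((slope h + coslope (σ k))⁻¹ * (blockC (σ k))⁻¹))
      atTop (𝓝 Q) := by
    have h1 : Tendsto (fun k => (slope h + coslope (σ k))⁻¹) atTop (𝓝 (slope h + G)⁻¹) :=
      (continuousAt_matrix_inv hunit).tendsto.comp (hG.const_add _)
    exact (h1.mul hP).const_mul _
  have hQ0 : Q ≠ 0 := by
    intro h0
    apply hP0
    have h2 : (slope h + G) * (blockC h * Q) = P := by
      rw [hQ, Matrix.mul_nonsing_inv_cancel_left _ _ hCh,
        Matrix.mul_nonsing_inv_cancel_left _ _ hunit]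
    rw [← h2, h0, Matrix.mul_zero, Matrix.mul_zero]
  have hinv : ∀ k, (slMat (σ k) * slMat h).toBlocks₂₁⁻¹ =
      (blockC h)⁻¹ * ((slope h + coslope (σ k))⁻¹ * (blockC (σ k))⁻¹) := fun k => by
    rw [hΓ.toBlocks₂₁_mul (hσ k).1 (hσ k).2 hh hh1, Matrix.mul_inv_rev, Matrix.mul_inv_rev]
  have hev : ∀ᶠ k in atTop, σ k * h ≠ 1 := by
    have := hinj.tendsto_cofinite.eventually (Set.finite_singleton h⁻¹).eventually_cofinite_notMem
    rw [Nat.cofinite_eq_atTop] at this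
    filter_upwards [this] with k hk hk'
    exact hk (eq_inv_of_mul_eq_one_left hk')
  have hblock : ∀ k, ∃ ζ : ℂ, ‖ζ‖ = 1 ∧
      blockC (σ k * h) = ζ • (slMat (σ k) * slMat h).toBlocks₂₁ := fun k => by
    obtain ⟨ζ, hζ, hmul⟩ := slMat_mul (σ k) h
    refine ⟨ζ, hζ, ?_⟩
    change (slMat (σ k * h)).toBlocks₂₁ = _
    rw [hmul]
    rfl
  have hnorm : ∀ k, opNorm (blockC (σ k * h))⁻¹ =
      opNorm ((slMat (σ k) * slMat h).toBlocks₂₁)⁻¹ := fun k => by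
    obtain ⟨ζ, hζ, hb⟩ := hblock k
    have hζ0 : ζ ≠ 0 := norm_ne_zero_iff.1 (by rw [hζ]; exact one_ne_zero)
    have hi : (ζ • (slMat (σ k) * slMat h).toBlocks₂₁)⁻¹ =
        ζ⁻¹ • (slMat (σ k) * slMat h).toBlocks₂₁⁻¹ := by
      -- A singular block occurs only when σ_k h = 1; there the convention that its inverse is 0
      -- keeps the identity true for every k.
      by_cases hu : IsUnit (slMat (σ k) * slMat h).toBlocks₂₁.det
      · exact Matrix.inv_smul' _ (Units.mk0 ζ hζ0) hu
      · rw [Matrix.nonsing_inv_apply_not_isUnit _ hu, smul_zero,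
          Matrix.nonsing_inv_apply_not_isUnit]
        rw [Matrix.det_smul]
        exact fun h' => hu (isUnit_of_mul_isUnit_right h')
    rw [hb, hi, opNorm_smul, norm_inv, hζ, inv_one, one_mul]
  have hr := hspade.eventually_eq (r := fun k => opNorm (blockC (σ k * h))⁻¹) (ρ := opNorm Q)
    (fun h0 => hQ0 (opNorm_eq_zero.1 h0))
    (hev.mono fun k hk => ⟨_, Γ.mul_mem (hσ k).1 hh, hk, rfl⟩)
    (by
      simp only [hnorm, hinv]
      exact (continuous_opNorm.tendsto Q).comp hlim)
  refine ⟨((opNorm Q ^ 2)⁻¹ : ℂ), inv_ne_zero (pow_ne_zero 2 ?_), ?_⟩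
  · exact_mod_cast fun h0 => hQ0 (opNorm_eq_zero.1 h0)
  · filter_upwards [hr, hev] with k hk hk1
    have hu : IsUnit (slMat (σ k) * slMat h).toBlocks₂₁.det := by
      have := hΓ.isUnit_det_blockC (Γ.mul_mem (hσ k).1 hh) hk1
      obtain ⟨ζ, -, hb⟩ := hblock k
      rw [hb, Matrix.det_smul] at this
      exact isUnit_of_mul_isUnit_right this
    have := det_conjTranspose_mul_self_sub_eq_zero hu
    rwa [← hnorm k, hk] at this

/-- Under (♣) and (♠), for every `ε > 0` only finitely many `g ∈ Γ` have `‖C_g⁻¹‖ ≥ ε`. -/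
theorem TubeDisjoint.finite_opNorm_ge (hΓ : TubeDisjoint Γ R) (hR : 0 ≤ R) {K : ℝ}
    (hK : ∀ g ∈ Γ, g ≠ 1 → opNorm (blockC g)⁻¹ ≤ K) (hspade : Spade Γ) {ε : ℝ} (hε : 0 < ε) :
    {g : PGrp n | (g ∈ Γ ∧ g ≠ 1) ∧ ε ≤ opNorm (blockC g)⁻¹}.Finite := by
  by_contra hinf
  set e := Set.Infinite.natEmbedding _ hinf with he
  obtain ⟨G, φ, hφ, hG⟩ := exists_subseq_tendsto_of_opNorm_le
    (x := fun k => coslope (e k : PGrp n)) (K := R)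
    fun k => hΓ.opNorm_coslope_le hR (e k).2.1.1 (e k).2.1.2
  obtain ⟨P, ψ, hψ, hP⟩ := exists_subseq_tendsto_of_opNorm_le
    (x := fun k => (blockC (e (φ k) : PGrp n))⁻¹) (K := K)
    fun k => hK _ (e (φ k)).2.1.1 (e (φ k)).2.1.2
  set σ : ℕ → PGrp n := fun k => e (φ (ψ k)) with hσdef
  have hσ : ∀ k, σ k ∈ Γ ∧ σ k ≠ 1 := fun k => (e (φ (ψ k))).2.1
  have hinj : Function.Injective σ :=
    Subtype.val_injective.comp (e.injective.comp (hφ.injective.comp hψ.injective))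
  have hP0 : P ≠ 0 := by
    rintro rfl
    have h1 := (continuous_opNorm.tendsto _).comp hP
    have h2 := ge_of_tendsto h1 (.of_forall fun k => (e (φ (ψ k))).2.2)
    rw [opNorm_eq_zero.2 rfl] at h2
    exact absurd h2 (not_le.2 hε)
  -- The fixed element h runs through the inverses of the sequence itself.
  choose t ht hev using fun μ => hΓ.exists_common_singular_value hspade hσ hinj
    (hG.comp hψ.tendsto_atTop) hP hP0 (Γ.inv_mem (hσ μ).1) (inv_ne_one.2 (hσ μ).2)
  choose ζ hζ hinv using fun μ => slMat_inv (σ μ)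
  have hζ0 : ∀ μ, ζ μ ≠ 0 := fun μ => norm_ne_zero_iff.1 (by rw [hζ]; exact one_ne_zero)
  refine false_of_common_singular_values (fun k => slMat (σ k))
    -- The scalar makes this the exact matrix inverse; having modulus 1, it does not affect singular
    -- values.
    (fun k => (ζ k)⁻¹ • slMat (σ k)⁻¹) (fun k => ?_) t ht fun μ => ?_
  · rw [hinv, smul_smul, inv_mul_cancel₀ (hζ0 k), one_smul,
      Matrix.mul_nonsing_inv _ (isUnit_det_slMat _)]
  · filter_upwards [hev μ] with ν hν
    have h1 : (slMat (σ ν) * (ζ μ)⁻¹ • slMat (σ μ)⁻¹).toBlocks₂₁ =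
        (ζ μ)⁻¹ • (slMat (σ ν) * slMat (σ μ)⁻¹).toBlocks₂₁ := by
      rw [Matrix.mul_smul]
      rfl
    have h2 : star (ζ μ)⁻¹ * (ζ μ)⁻¹ = 1 := by
      rw [← starRingEnd_apply, Complex.conj_mul', norm_inv, hζ]
      simp
    rw [h1, Matrix.conjTranspose_smul, Matrix.smul_mul, Matrix.mul_smul, smul_smul, h2, one_smul]
    exact hν

end TypeL

namespace TypeL

variable {n : ℕ}

/-! ### Normalized representatives -/

/-- The largest modulus of an entry. -/
noncomputable def entrySup {ι : Type*} [Fintype ι] (A : Matrix ι ι ℂ) : ℝ :=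
  ‖fun p : ι × ι => A p.1 p.2‖

section Normalize

variable {ι : Type*} [Fintype ι]

theorem continuous_entrySup : Continuous (entrySup (ι := ι)) :=
  (continuous_pi fun p : ι × ι => (continuous_apply p.2).comp (continuous_apply p.1)).norm

theorem entrySup_ne_zero {A : Matrix ι ι ℂ} (hA : A ≠ 0) : entrySup A ≠ 0 := by
  rw [entrySup, norm_ne_zero_iff]
  intro h
  apply hA
  ext i j
  exact congrFun h (i, j)

theorem maxEntryOne_normalize {A : Matrix ι ι ℂ} (hA : A ≠ 0) :
    MaxEntryOne ((entrySup A : ℂ)⁻¹ • A) := by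
  have h0 : 0 < entrySup A := (norm_nonneg _).lt_of_ne' (entrySup_ne_zero hA)
  have hval : ∀ i j, ‖((entrySup A : ℂ)⁻¹ • A) i j‖ = (entrySup A)⁻¹ * ‖A i j‖ := fun i j => by
    rw [Matrix.smul_apply, norm_smul, norm_inv, Complex.norm_real, Real.norm_of_nonneg h0.le]
  have hle : ∀ i j, ‖A i j‖ ≤ entrySup A := fun i j =>
    norm_le_pi_norm (fun p : ι × ι => A p.1 p.2) (i, j)
  refine ⟨fun i j => ?_, ?_⟩
  · rw [hval, inv_mul_le_one₀ h0]
    exact hle i j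
  · have : Nonempty (ι × ι) := by
      by_contra hemp
      rw [not_nonempty_iff] at hemp
      exact hA (Matrix.ext fun i j => (hemp.false (i, j)).elim)
    obtain ⟨p, hp⟩ := Finite.exists_max fun p : ι × ι => ‖A p.1 p.2‖
    refine ⟨p.1, p.2, ?_⟩
    rw [hval, (hle p.1 p.2).antisymm ((pi_norm_le_iff_of_nonneg (norm_nonneg _)).2 hp),
      inv_mul_cancel₀ h0.ne']

theorem tendsto_normalize {A : ℕ → Matrix ι ι ℂ} {A₀ : Matrix ι ι ℂ}
    (hA : Tendsto A atTop (𝓝 A₀)) (h0 : A₀ ≠ 0) :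
    Tendsto (fun k => (entrySup (A k) : ℂ)⁻¹ • A k) atTop (𝓝 ((entrySup A₀ : ℂ)⁻¹ • A₀)) := by
  have h1 := ((Complex.continuous_ofReal.comp continuous_entrySup).tendsto A₀).comp hA
  exact (h1.inv₀ (Complex.ofReal_ne_zero.2 (entrySup_ne_zero h0))).smul hA

theorem MaxEntryOne.ne_zero_of_tendsto {A : ℕ → Matrix ι ι ℂ} {A₀ : Matrix ι ι ℂ}
    (hA : Tendsto A atTop (𝓝 A₀)) (h : ∀ k, MaxEntryOne (A k)) : A₀ ≠ 0 := by
  have h1 : ∀ k, entrySup (A k) = 1 := fun k => by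
    obtain ⟨hle, i, j, hij⟩ := h k
    refine le_antisymm ((pi_norm_le_iff_of_nonneg zero_le_one).2 fun p => hle p.1 p.2) ?_
    rw [← hij]
    exact norm_le_pi_norm (fun p : ι × ι => A k p.1 p.2) (i, j)
  rintro rfl
  have h2 := (continuous_entrySup.tendsto _).comp hA
  have h3 : entrySup (0 : Matrix ι ι ℂ) = 0 := norm_zero
  rw [h3] at h2
  have h4 : Tendsto (fun _ : ℕ => (1 : ℝ)) atTop (𝓝 0) := by
    simpa only [Function.comp_def, h1] using h2
  exact one_ne_zero (tendsto_nhds_unique tendsto_const_nhds h4)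

end Normalize

theorem IsHatRep.smul {S : Matrix (MultiIdx n) (MultiIdx n) ℂ} {g : PGrp n} (h : IsHatRep S g)
    {c : ℂ} (hc : c ≠ 0) : IsHatRep (c • S) g := by
  obtain ⟨A, hA, b, hb, rfl⟩ := h
  exact ⟨A, hA, c * b, mul_ne_zero hc hb, smul_smul _ _ _⟩

theorem IsHatRep.mul {S : Matrix (MultiIdx n) (MultiIdx n) ℂ} {g h : PGrp n}
    (hS : IsHatRep S h) : IsHatRep (compound (slMat g) * S) (g * h) := by
  obtain ⟨A, hA, b, hb, rfl⟩ := hS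
  exact ⟨slMat g * A, (isRep_slMat g).mul hA, b, hb, by rw [compound_mul, Matrix.mul_smul]⟩

theorem compound_inv_mul_cancel (g : PGrp n) (S : Matrix (MultiIdx n) (MultiIdx n) ℂ) :
    compound (slMat g)⁻¹ * (compound (slMat g) * S) = S := by
  rw [← Matrix.mul_assoc, ← compound_mul, Matrix.nonsing_inv_mul _ (isUnit_det_slMat g),
    compound_one, Matrix.one_mul]

theorem compound_slMat_mul_ne_zero {g : PGrp n} {S : Matrix (MultiIdx n) (MultiIdx n) ℂ}
    (hS : S ≠ 0) : compound (slMat g) * S ≠ 0 := fun h =>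
  hS (by rw [← compound_inv_mul_cancel g S, h, Matrix.mul_zero])

theorem IsRep.ne_zero {A : Matrix (Idx n) (Idx n) ℂ} {g : PGrp n} (hA : IsRep A g) : A ≠ 0 := by
  rintro rfl
  exact hA.det_ne_zero Matrix.det_zero

theorem IsHatRep.ne_zero {S : Matrix (MultiIdx n) (MultiIdx n) ℂ} {g : PGrp n}
    (hS : IsHatRep S g) : S ≠ 0 := by
  obtain ⟨A, hA, b, hb, rfl⟩ := hS
  refine smul_ne_zero hb fun h => ?_
  have h1 : compound (A⁻¹) * compound A = 1 := by
    rw [← compound_mul, Matrix.nonsing_inv_mul _ (isUnit_iff_ne_zero.2 hA.det_ne_zero),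
      compound_one]
  rw [h, Matrix.mul_zero] at h1
  have h2 := congrFun (congrFun h1 (OrderEmbedding.ofStrictMono _ Sum.Lex.inl_strictMono))
    (OrderEmbedding.ofStrictMono _ Sum.Lex.inl_strictMono)
  simp at h2

/-- A sequence of distinct elements is normal as soon as it has, on both levels, representatives
with nonzero limits; the limit image is the image of the limit. -/
theorem exists_isNormalSeq {Γ : Subgroup (PGrp n)} {σ : ℕ → PGrp n} (hσ : ∀ k, σ k ∈ Γ)
    (hinj : Function.Injective σ) {T : ℕ → Matrix (Idx n) (Idx n) ℂ}
    {T₀ : Matrix (Idx n) (Idx n) ℂ} (hT : ∀ k, IsRep (T k) (σ k)) (hTlim : Tendsto T atTop (𝓝 T₀))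
    (hT₀ : T₀ ≠ 0) {S : ℕ → Matrix (MultiIdx n) (MultiIdx n) ℂ}
    {S₀ : Matrix (MultiIdx n) (MultiIdx n) ℂ} (hS : ∀ k, IsHatRep (S k) (σ k))
    (hSlim : Tendsto S atTop (𝓝 S₀)) (hS₀ : S₀ ≠ 0) :
    ∃ S', IsNormalSeq Γ σ S' ∧ LinearMap.range S₀.mulVecLin ≤ LinearMap.range S'.mulVecLin := by
  refine ⟨(entrySup S₀ : ℂ)⁻¹ • S₀, ⟨hσ, hinj, ?_, ?_⟩, ?_⟩
  · refine ⟨_, _, fun k => ⟨(hT k).smul ?_, maxEntryOne_normalize (hT k).ne_zero⟩,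
      tendsto_normalize hTlim hT₀⟩
    exact inv_ne_zero (Complex.ofReal_ne_zero.2 (entrySup_ne_zero (hT k).ne_zero))
  · refine ⟨_, fun k => ⟨(hS k).smul ?_, maxEntryOne_normalize (hS k).ne_zero⟩,
      tendsto_normalize hSlim hS₀⟩
    exact inv_ne_zero (Complex.ofReal_ne_zero.2 (entrySup_ne_zero (hS k).ne_zero))
  · rintro _ ⟨y, rfl⟩
    refine ⟨(entrySup S₀ : ℂ) • y, ?_⟩
    rw [map_smul, Matrix.mulVecLin_apply, Matrix.mulVecLin_apply, Matrix.smul_mulVec,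
      smul_smul, mul_inv_cancel₀ (Complex.ofReal_ne_zero.2 (entrySup_ne_zero hS₀)), one_smul]

/-! ### Invariance of the limit set -/

theorem slMat_mulVecLin_injective (g : PGrp n) : Function.Injective (slMat g).mulVecLin :=
  Matrix.mulVec_injective_iff_isUnit.2
    ((Matrix.isUnit_iff_isUnit_det _).2 (isUnit_det_slMat g))

/-- If σ is a normal sequence with limit S, then gσ has limits g T₀ and ĝ S up to scaling, nonzero
because g is invertible, and ĝ maps Plücker vectors of L to those of gL. -/
theorem IsLimitPlane.map {Γ : Subgroup (PGrp n)} {L : Submodule ℂ (Idx n → ℂ)}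
    (hL : IsLimitPlane Γ L) {g : PGrp n} (hg : g ∈ Γ) :
    IsLimitPlane Γ (L.map (slMat g).mulVecLin) := by
  obtain ⟨hplane, σ, S, hσ, p, ⟨X, hX, hXL, rfl⟩, y, hy⟩ := hL
  obtain ⟨T, T₀, hT, hTlim⟩ := hσ.convergent
  obtain ⟨U, hU, hUlim⟩ := hσ.hat_convergent
  have hT₀ : slMat g * T₀ ≠ 0 := fun h => by
    refine MaxEntryOne.ne_zero_of_tendsto hTlim (fun k => (hT k).2) ?_
    rw [← Matrix.nonsing_inv_mul_cancel_left _ T₀ (isUnit_det_slMat g), h, Matrix.mul_zero]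
  obtain ⟨S', hS', hle⟩ := exists_isNormalSeq (Γ := Γ) (σ := fun k => g * σ k)
    (fun k => Γ.mul_mem hg (hσ.mem k)) ((mul_right_injective g).comp hσ.distinct)
    (fun k => (isRep_slMat g).mul (hT k).1) (hTlim.const_mul _) hT₀
    (fun k => (hU k).1.mul) (hUlim.const_mul _)
    (compound_slMat_mul_ne_zero (MaxEntryOne.ne_zero_of_tendsto hUlim fun k => (hU k).2))
  have hcol : (fun j => (slMat g * X).col j) = (slMat g).mulVecLin ∘ fun j => X.col j := by
    ext j i
    simp [Matrix.col, Matrix.mul_apply, Matrix.mulVec, dotProduct]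
  refine ⟨?_, _, S', hS', plucker (slMat g * X), ⟨slMat g * X, ?_, ?_, rfl⟩, hle ⟨y, ?_⟩⟩
  · exact (Submodule.equivMapOfInjective _ (slMat_mulVecLin_injective g) L).finrank_eq.symm.trans
      hplane
  · rw [hcol]
    exact hX.map' _ (LinearMap.ker_eq_bot.2 (slMat_mulVecLin_injective g))
  · rw [hcol, Set.range_comp, ← Submodule.map_span, hXL]
  · rw [plucker_mul, ← hy]
    simp

theorem mk_mem_support {L : Submodule ℂ (Idx n → ℂ)} {v : Idx n → ℂ} (hv : v ≠ 0) :
    Projectivization.mk ℂ v hv ∈ support L ↔ v ∈ L := by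
  change (Projectivization.mk ℂ v hv).submodule ≤ L ↔ v ∈ L
  rw [Projectivization.submodule_mk, Submodule.span_singleton_le_iff_mem]

theorem smul_mem_limitSet {Γ : Subgroup (PGrp n)} {g : PGrp n} (hg : g ∈ Γ) {z : PSpace n}
    (hz : z ∈ limitSet Γ) : g • z ∈ limitSet Γ := by
  induction z using Projectivization.ind with | h v hv => ?_
  simp only [limitSet, Set.mem_iUnion] at hz ⊢
  obtain ⟨L, hL, hvL⟩ := hz
  refine ⟨_, hL.map hg, ?_⟩
  rw [smul_mk_eq, mk_mem_support]
  exact ⟨v, (mk_mem_support hv).1 hvL, rfl⟩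

theorem smul_mem_Omega {Γ : Subgroup (PGrp n)} {g : PGrp n} (hg : g ∈ Γ) {z : PSpace n}
    (hz : z ∈ Omega Γ) : g • z ∈ Omega Γ := fun h =>
  hz (by simpa using smul_mem_limitSet (Γ.inv_mem hg) h)

/-! ### Graphs over `z''` -/

/-- The matrix whose columns span the graph `z' = H z''`. -/
def graphMat (H : Matrix (Fin (n + 1)) (Fin (n + 1)) ℂ) : Matrix (Idx n) (Fin (n + 1)) ℂ :=
  Matrix.fromRows H 1

theorem graphMat_mulVec (H : Matrix (Fin (n + 1)) (Fin (n + 1)) ℂ) (y : Fin (n + 1) → ℂ) :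
    (graphMat H).mulVec y = Sum.elim (H.mulVec y) y := by
  rw [graphMat, Matrix.fromRows_mulVec, Matrix.one_mulVec]

theorem linearIndependent_col_graphMat (H : Matrix (Fin (n + 1)) (Fin (n + 1)) ℂ) :
    LinearIndependent ℂ fun j => (graphMat H).col j := by
  refine Matrix.mulVec_injective_iff.1 fun x y hxy => ?_
  rw [graphMat_mulVec, graphMat_mulVec] at hxy
  exact congrArg sndPart hxy

theorem isPlane_graph (H : Matrix (Fin (n + 1)) (Fin (n + 1)) ℂ) :
    IsPlane (Submodule.span ℂ (Set.range fun j => (graphMat H).col j)) := by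
  rw [IsPlane, finrank_span_eq_card (linearIndependent_col_graphMat H), Fintype.card_fin]

/-- The first multi-index, consisting of the coordinates of `z'`. -/
def MultiIdx.fst : MultiIdx n := OrderEmbedding.ofStrictMono _ Sum.Lex.inl_strictMono

/-- The last multi-index, consisting of the coordinates of `z''`. -/
def MultiIdx.snd : MultiIdx n := OrderEmbedding.ofStrictMono _ Sum.Lex.inr_strictMono

theorem plucker_graphMat_snd (H : Matrix (Fin (n + 1)) (Fin (n + 1)) ℂ) :
    plucker (graphMat H) MultiIdx.snd = 1 := by
  have : (graphMat H).submatrix (MultiIdx.snd (n := n)).at id = 1 := by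
    ext i j
    rfl
  rw [plucker, this, Matrix.det_one]

end TypeL

namespace TypeL

variable {n : ℕ} {Γ : Subgroup (PGrp n)} {R K : ℝ}

/-! ### Limits of the images of `z'' = 0` are limit planes -/

/-- `A_g C_g⁻¹ D_g - B_g`, which up to a unit is `-C_{g⁻¹}⁻¹`. -/
noncomputable def schurBlock (g : PGrp n) : Matrix (Fin (n + 1)) (Fin (n + 1)) ℂ :=
  blockA g * coslope g - blockB g

/-- The second block row of g g⁻¹ = ζ gives A_{g⁻¹} = -C_g⁻¹D_g C_{g⁻¹}; inserted in the first row,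
it identifies the block as -ζ C_{g⁻¹}⁻¹. So (♣), applied to g⁻¹, bounds it. -/
theorem TubeDisjoint.opNorm_schurBlock (hΓ : TubeDisjoint Γ R) {g : PGrp n} (hg : g ∈ Γ)
    (h1 : g ≠ 1) : opNorm (schurBlock g) = opNorm (blockC g⁻¹)⁻¹ := by
  have hC := hΓ.isUnit_det_blockC hg h1
  have hC' := hΓ.isUnit_det_blockC (Γ.inv_mem hg) (inv_ne_one.2 h1)
  obtain ⟨ζ, hζ, hinv⟩ := slMat_inv g
  have hmul : slMat g * slMat g⁻¹ = ζ • 1 := by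
    rw [hinv, Matrix.mul_smul, Matrix.mul_nonsing_inv _ (isUnit_det_slMat g)]
  rw [slMat_eq_fromBlocks g, slMat_eq_fromBlocks g⁻¹, Matrix.fromBlocks_multiply,
    ← Matrix.fromBlocks_one, Matrix.fromBlocks_smul, Matrix.fromBlocks_inj] at hmul
  obtain ⟨h11, -, h21, -⟩ := hmul
  rw [smul_zero] at h21
  have hA' : blockA g⁻¹ = -(coslope g * blockC g⁻¹) := by
    rw [← Matrix.nonsing_inv_mul_cancel_left _ (blockA g⁻¹) hC, eq_neg_of_add_eq_zero_left h21,
      coslope, Matrix.mul_neg, Matrix.mul_assoc]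
  have hE : schurBlock g * blockC g⁻¹ = -(ζ • 1) := by
    rw [← h11, hA', schurBlock, sub_mul, Matrix.mul_neg, Matrix.mul_assoc]
    abel
  have hE' : schurBlock g = (-ζ) • (blockC g⁻¹)⁻¹ := by
    rw [← Matrix.mul_nonsing_inv_cancel_right _ (schurBlock g) hC', hE, neg_mul, Matrix.smul_mul,
      Matrix.one_mul, neg_smul]
  rw [hE', opNorm_smul, norm_neg, hζ, one_mul]

/-- A bordered determinant. For `P = C_g⁻¹`, `H = A_g C_g⁻¹`, `G = C_g⁻¹ D_g` and `E` the Schur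
block it is, up to sign, a minor of the representative of `g` divided by `det C_g`. -/
noncomputable def borderedMinor (K J : MultiIdx n)
    (x : Matrix (Fin (n + 1)) (Fin (n + 1)) ℂ × Matrix (Fin (n + 1)) (Fin (n + 1)) ℂ ×
      Matrix (Fin (n + 1)) (Fin (n + 1)) ℂ × Matrix (Fin (n + 1)) (Fin (n + 1)) ℂ) : ℂ :=
  (Matrix.fromBlocks x.1 ((Matrix.fromCols 1 x.2.2.1).submatrix id J.at)
    ((graphMat x.2.1).submatrix K.at id)
    ((Matrix.fromBlocks 0 x.2.2.2 0 0).submatrix K.at J.at)).det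

theorem continuous_borderedMinor (K J : MultiIdx n) : Continuous (borderedMinor K J) := by
  have h1 : Continuous fun x : Matrix (Fin (n + 1)) (Fin (n + 1)) ℂ =>
      (Matrix.fromCols 1 x : Matrix (Fin (n + 1)) (Idx n) ℂ) := by
    refine continuous_matrix fun i => ?_
    rintro (j | j)
    · exact continuous_const
    · exact continuous_id.matrix_elem i j
  have h2 : Continuous fun x : Matrix (Fin (n + 1)) (Fin (n + 1)) ℂ => graphMat x := by
    refine continuous_matrix ?_
    rintro (i | i) j
    · exact continuous_id.matrix_elem i j
    · exact continuous_const
  refine Continuous.matrix_det (Continuous.matrix_fromBlocks continuous_fst ?_ ?_ ?_)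
  · exact (h1.comp (continuous_fst.comp (continuous_snd.comp continuous_snd))).matrix_submatrix _ _
  · exact (h2.comp (continuous_fst.comp continuous_snd)).matrix_submatrix _ _
  · exact (Continuous.matrix_fromBlocks continuous_const
      (continuous_snd.comp (continuous_snd.comp continuous_snd)) continuous_const
      continuous_const).matrix_submatrix _ _

theorem TubeDisjoint.slMat_eq (hΓ : TubeDisjoint Γ R) {g : PGrp n} (hg : g ∈ Γ) (h1 : g ≠ 1) :
    slMat g = graphMat (slope g) * blockC g * Matrix.fromCols 1 (coslope g) -
      Matrix.fromBlocks 0 (schurBlock g) 0 0 := by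
  have hC := hΓ.isUnit_det_blockC hg h1
  rw [graphMat, Matrix.fromRows_mul, Matrix.fromRows_mul_fromCols, slMat_eq_fromBlocks, slope,
    Matrix.nonsing_inv_mul_cancel_right _ _ hC, schurBlock, Matrix.one_mul, Matrix.mul_one,
    Matrix.mul_one, coslope, Matrix.mul_nonsing_inv_cancel_left _ _ hC]
  ext (i | i) (j | j) <;> simp

/-- The Schur complement formula for a determinant with corner C_g⁻¹. It expresses the normalized
minors by convergent blocks only, although C_g may diverge. -/
theorem TubeDisjoint.compound_slMat (hΓ : TubeDisjoint Γ R) {g : PGrp n} (hg : g ∈ Γ)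
    (h1 : g ≠ 1) (K J : MultiIdx n) :
    ((blockC g).det)⁻¹ * compound (slMat g) K J =
      (-1) ^ (n + 1) * borderedMinor K J ((blockC g)⁻¹, slope g, coslope g, schurBlock g) := by
  have hC := hΓ.isUnit_det_blockC hg h1
  let _ : Invertible (blockC g)⁻¹ :=
    Matrix.invertibleOfIsUnitDet _ (Matrix.isUnit_nonsing_inv_det _ hC)
  have hsub : (slMat g).submatrix K.at J.at =
      (-1 : ℂ) • ((Matrix.fromBlocks 0 (schurBlock g) 0 0).submatrix K.at J.at -
        (graphMat (slope g)).submatrix K.at id * ⅟((blockC g)⁻¹) *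
          (Matrix.fromCols 1 (coslope g)).submatrix id J.at) := by
    rw [Matrix.invOf_eq_nonsing_inv, Matrix.nonsing_inv_nonsing_inv _ hC, hΓ.slMat_eq hg h1,
      neg_one_smul, neg_sub]
    rfl
  rw [borderedMinor, Matrix.det_fromBlocks₁₁, Matrix.det_nonsing_inv, Ring.inverse_eq_inv',
    mul_left_comm]
  congr 1
  change ((slMat g).submatrix K.at J.at).det = _
  rw [hsub, Matrix.det_smul, Fintype.card_fin]

theorem TubeDisjoint.compound_slMat_fst (hΓ : TubeDisjoint Γ R) {g : PGrp n} (hg : g ∈ Γ)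
    (h1 : g ≠ 1) (K : MultiIdx n) :
    ((blockC g).det)⁻¹ * compound (slMat g) K MultiIdx.fst = plucker (graphMat (slope g)) K := by
  have hC := hΓ.isUnit_det_blockC hg h1
  have hsub : (slMat g).submatrix K.at (MultiIdx.fst (n := n)).at =
      (graphMat (slope g)).submatrix K.at id * blockC g := by
    have : (slMat g).submatrix id Sum.inl = graphMat (slope g) * blockC g := by
      rw [graphMat, Matrix.fromRows_mul, slope, Matrix.nonsing_inv_mul_cancel_right _ _ hC,
        Matrix.one_mul, slMat_eq_fromBlocks]
      ext (i | i) j <;> rfl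
    change ((slMat g).submatrix id Sum.inl).submatrix K.at id = _
    rw [this]
    rfl
  change _ * ((slMat g).submatrix K.at (MultiIdx.fst (n := n)).at).det = _
  rw [hsub, Matrix.det_mul, mul_comm, mul_assoc, mul_inv_cancel₀ hC.ne_zero, mul_one]
  rfl

theorem continuous_plucker_graphMat : Continuous fun H => plucker (graphMat (n := n) H) := by
  refine continuous_pi fun K => Continuous.matrix_det (Continuous.matrix_submatrix ?_ _ _)
  refine continuous_matrix ?_
  rintro (i | i) j
  · exact continuous_id.matrix_elem i j
  · exact continuous_const

/-- The limits of the images of the `n`-plane `z'' = 0` under distinct elements of `Γ` are limit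
`n`-planes. -/
theorem TubeDisjoint.isLimitPlane_of_tendsto_slope (hΓ : TubeDisjoint Γ R) (hR : 0 ≤ R)
    (hK : ∀ g ∈ Γ, g ≠ 1 → opNorm (blockC g)⁻¹ ≤ K) {σ : ℕ → PGrp n}
    (hσ : ∀ k, σ k ∈ Γ ∧ σ k ≠ 1) (hinj : Function.Injective σ)
    {H : Matrix (Fin (n + 1)) (Fin (n + 1)) ℂ} (hH : Tendsto (fun k => slope (σ k)) atTop (𝓝 H)) :
    IsLimitPlane Γ (Submodule.span ℂ (Set.range fun j => (graphMat H).col j)) := by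
  have hcomp := (isCompact_entries_le (ι := Idx n) (κ := Idx n) 1).prod
    ((isCompact_entries_le (ι := Fin (n + 1)) (κ := Fin (n + 1)) K).prod
      ((isCompact_entries_le (ι := Fin (n + 1)) (κ := Fin (n + 1)) R).prod
        (isCompact_entries_le (ι := Fin (n + 1)) (κ := Fin (n + 1)) K)))
  obtain ⟨⟨T₀, P, G, E⟩, -, φ, hφ, hlim⟩ := hcomp.tendsto_subseq
    (x := fun k => ((entrySup (slMat (σ k)) : ℂ)⁻¹ • slMat (σ k),
      (blockC (σ k))⁻¹, coslope (σ k), schurBlock (σ k)))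
    fun k => ⟨(maxEntryOne_normalize (isRep_slMat (σ k)).ne_zero).1,
      fun i j => (norm_apply_le_opNorm _ i j).trans (hK _ (hσ k).1 (hσ k).2),
      fun i j => (norm_apply_le_opNorm _ i j).trans (hΓ.opNorm_coslope_le hR (hσ k).1 (hσ k).2),
      fun i j => (norm_apply_le_opNorm _ i j).trans (by
        rw [hΓ.opNorm_schurBlock (hσ k).1 (hσ k).2]
        exact hK _ (Γ.inv_mem (hσ k).1) (inv_ne_one.2 (hσ k).2))⟩
  have hT := (continuous_fst.tendsto _).comp hlim
  have hrest := (continuous_snd.tendsto _).comp hlim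
  have hP := (continuous_fst.tendsto _).comp hrest
  have hGE := (continuous_snd.tendsto _).comp hrest
  have hH' := hH.comp hφ.tendsto_atTop
  have hall := hP.prodMk_nhds (hH'.prodMk_nhds hGE)
  -- The limit of ĝ divided by det C_g. Its `MultiIdx.fst` column is the Plücker vector of the limit
  -- graph, which therefore lies in the image; the `MultiIdx.snd` coordinate 1 shows S₀ ≠ 0.
  set S₀ : Matrix (MultiIdx n) (MultiIdx n) ℂ :=
    Matrix.of fun K J => (-1) ^ (n + 1) * borderedMinor K J (P, H, G, E) with hS₀
  have hS : Tendsto (fun k => ((blockC (σ (φ k))).det)⁻¹ • compound (slMat (σ (φ k)))) atTop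
      (𝓝 S₀) := by
    refine tendsto_pi_nhds.2 fun K => tendsto_pi_nhds.2 fun J => ?_
    refine Tendsto.congr (fun k => (hΓ.compound_slMat (hσ (φ k)).1 (hσ (φ k)).2 K J).symm) ?_
    exact (((continuous_borderedMinor K J).tendsto _).comp hall).const_mul _
  have hcol : ∀ K, S₀ K MultiIdx.fst = plucker (graphMat H) K := fun K => by
    refine tendsto_nhds_unique (tendsto_pi_nhds.1 (tendsto_pi_nhds.1 hS K) MultiIdx.fst) ?_
    refine Tendsto.congr
      (fun k => (hΓ.compound_slMat_fst (hσ (φ k)).1 (hσ (φ k)).2 K).symm) ?_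
    exact tendsto_pi_nhds.1 ((continuous_plucker_graphMat.tendsto H).comp hH') K
  have hS₀0 : S₀ ≠ 0 := fun h => by
    have := hcol MultiIdx.snd
    rw [plucker_graphMat_snd, h] at this
    exact zero_ne_one this
  obtain ⟨S', hS', hle⟩ := exists_isNormalSeq (Γ := Γ) (σ := fun k => σ (φ k))
    (fun k => (hσ _).1) (hinj.comp hφ.injective)
    (fun k => (isRep_slMat (σ (φ k))).smul (inv_ne_zero (Complex.ofReal_ne_zero.2
      (entrySup_ne_zero (isRep_slMat (σ (φ k))).ne_zero)))) hT
    (MaxEntryOne.ne_zero_of_tendsto hT fun k =>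
      maxEntryOne_normalize (isRep_slMat (σ (φ k))).ne_zero)
    (fun k => ⟨_, isRep_slMat (σ (φ k)), _,
      inv_ne_zero (hΓ.isUnit_det_blockC (hσ (φ k)).1 (hσ (φ k)).2).ne_zero, rfl⟩) hS hS₀0
  refine ⟨isPlane_graph H, _, S', hS', plucker (graphMat H),
    ⟨graphMat H, linearIndependent_col_graphMat H, rfl, rfl⟩, hle ⟨Pi.single MultiIdx.fst 1, ?_⟩⟩
  rw [Matrix.mulVecLin_apply, Matrix.mulVec_single_one]
  exact funext hcol

/-- The image of z'' = 0 under g⁻¹ is its preimage under g; both matrices describe the same graph.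
-/
theorem TubeDisjoint.slope_inv (hΓ : TubeDisjoint Γ R) {g : PGrp n} (hg : g ∈ Γ) (h1 : g ≠ 1) :
    slope g⁻¹ = -coslope g := by
  obtain ⟨ζ, hζ, hinv⟩ := slMat_inv g
  refine Matrix.mulVec_injective (funext fun y => ?_)
  have h2 : sndPart ((slMat g).mulVec (Sum.elim ((slope g⁻¹).mulVec y) y)) = 0 := by
    rw [← hΓ.slMat_mulVec_blockC_inv (Γ.inv_mem hg) (inv_ne_one.2 h1), hinv, Matrix.smul_mulVec,
      Matrix.mulVec_smul, slMat_mulVec_inv_mulVec, sndPart_smul, sndPart_elim, smul_zero]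
  have h3 := hΓ.fst_add_coslope hg h1 (Sum.elim ((slope g⁻¹).mulVec y) y)
  rw [h2, Matrix.mulVec_zero, fstPart_elim, sndPart_elim] at h3
  rw [Matrix.neg_mulVec]
  exact eq_neg_of_add_eq_zero_left h3

theorem exists_injective_seq {α : Type*} {s : ℕ → Set α} (hs : ∀ k, (s k).Infinite)
    (hanti : Antitone s) : ∃ f : ℕ → α, Function.Injective f ∧ ∀ k, f k ∈ s k := by
  classical
  -- Choosing pairs (level, element) with strictly increasing levels yields distinct elements whose
  -- k-th level is at least k.
  obtain ⟨f, hf, hr⟩ := exists_seq_of_forall_finset_exists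
    (fun p : ℕ × α => p.2 ∈ s p.1) (fun p q => p.1 < q.1 ∧ p.2 ≠ q.2) fun t _ => by
      obtain ⟨y, hy, hyt⟩ := (hs (t.sup Prod.fst + 1)).exists_notMem_finset (t.image Prod.snd)
      refine ⟨(t.sup Prod.fst + 1, y), hy, fun x hx => ⟨?_, ?_⟩⟩
      · exact Nat.lt_succ_of_le (Finset.le_sup (f := Prod.fst) hx)
      · rintro rfl
        exact hyt (Finset.mem_image_of_mem _ hx)
  have hmono : StrictMono fun k => (f k).1 := fun a b hab => (hr a b hab).1
  refine ⟨fun k => (f k).2, ?_, fun k => hanti hmono.le_apply (hf k)⟩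
  intro a b hab
  rcases lt_trichotomy a b with h | h | h
  · exact absurd hab (hr a b h).2
  · exact h
  · exact absurd hab.symm (hr b a h).2

/-- A point of `Ω` stays away from the planes `z' = -C_g⁻¹ D_g z''`, with finitely many
exceptions. -/
theorem TubeDisjoint.exists_finite_coslope (hΓ : TubeDisjoint Γ R) (hR : 0 ≤ R)
    (hK : ∀ g ∈ Γ, g ≠ 1 → opNorm (blockC g)⁻¹ ≤ K) {w : Idx n → ℂ} (hw : w ≠ 0)
    (hmem : Projectivization.mk ℂ w hw ∈ Omega Γ) :
    ∃ η > 0, {g : PGrp n | (g ∈ Γ ∧ g ≠ 1) ∧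
      enorm2 (fstPart w + (coslope g).mulVec (sndPart w)) < η}.Finite := by
  by_contra! hinf
  obtain ⟨f, hf, hfs⟩ := exists_injective_seq
    (s := fun k : ℕ => {g : PGrp n | (g ∈ Γ ∧ g ≠ 1) ∧
      enorm2 (fstPart w + (coslope g).mulVec (sndPart w)) < 1 / ((k : ℝ) + 1)})
    (fun k => hinf _ Nat.one_div_pos_of_nat)
    (fun a b hab g hg => ⟨hg.1, hg.2.trans_le (Nat.one_div_le_one_div hab)⟩)
  obtain ⟨G, φ, hφ, hG⟩ := exists_subseq_tendsto_of_opNorm_le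
    (x := fun k => coslope (f k)) (K := R)
    fun k => hΓ.opNorm_coslope_le hR (hfs k).1.1 (hfs k).1.2
  have hplane := hΓ.isLimitPlane_of_tendsto_slope hR hK (σ := fun k => (f (φ k))⁻¹)
    (fun k => ⟨Γ.inv_mem (hfs (φ k)).1.1, inv_ne_one.2 (hfs (φ k)).1.2⟩)
    (inv_injective.comp (hf.comp hφ.injective)) (H := -G) (by
      refine Tendsto.congr (fun k => ?_) hG.neg
      exact (hΓ.slope_inv (hfs (φ k)).1.1 (hfs (φ k)).1.2).symm)
  have hcont : Continuous fun X : Matrix (Fin (n + 1)) (Fin (n + 1)) ℂ =>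
      enorm2 (fstPart w + X.mulVec (sndPart w)) :=
    continuous_enorm2.comp (continuous_const.add (continuous_id.matrix_mulVec continuous_const))
  have hzero : enorm2 (fstPart w + G.mulVec (sndPart w)) ≤ 0 := by
    refine le_of_tendsto_of_tendsto ((hcont.tendsto G).comp hG)
      (tendsto_one_div_add_atTop_nhds_zero_nat.comp hφ.tendsto_atTop)
      (.of_forall fun k => (hfs (φ k)).2.le)
  have hw' := eq_neg_of_add_eq_zero_left (enorm2_eq_zero.1 (hzero.antisymm (enorm2_nonneg _)))
  refine hmem (Set.mem_iUnion₂.2 ⟨_, hplane, (mk_mem_support hw).2 ?_⟩)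
  change w ∈ Submodule.span ℂ (Set.range (graphMat (-G)).col)
  rw [← Matrix.range_mulVecLin]
  refine ⟨sndPart w, ?_⟩
  rw [Matrix.mulVecLin_apply, graphMat_mulVec, Matrix.neg_mulVec, ← hw', elim_fstPart_sndPart]

end TypeL

namespace TypeL

variable {n : ℕ} {Γ : Subgroup (PGrp n)} {R K : ℝ}

/-! ### The F-region -/

theorem mk_mem_iInter_deltaBar {v : Idx n → ℂ} (hv : v ≠ 0) :
    Projectivization.mk ℂ v hv ∈ (⋂ (g : PGrp n) (_ : g ∈ Γ ∧ g ≠ 1), deltaBar g) ↔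
      ∀ g ∈ Γ, g ≠ 1 → sndNorm v ≤ movedNorm g v := by
  simp only [Set.mem_iInter, mk_mem_deltaBar, and_imp]

theorem mk_mem_FRegion_of_eventually {v : Idx n → ℂ} (hv : v ≠ 0)
    (h : ∀ᶠ u in 𝓝 v, ∀ g ∈ Γ, g ≠ 1 → sndNorm u ≤ movedNorm g u) :
    Projectivization.mk ℂ v hv ∈ FRegion Γ := by
  obtain ⟨U, hU, hUo, hvU⟩ := eventually_nhds_iff.1 h
  have hset : {z : PSpace n | ∃ u ∈ U, ∃ hu : u ≠ 0, Projectivization.mk ℂ u hu = z} ⊆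
      ⋂ (g : PGrp n) (_ : g ∈ Γ ∧ g ≠ 1), deltaBar g := by
    rintro _ ⟨u, hu, hu0, rfl⟩
    exact (mk_mem_iInter_deltaBar hu0).2 (hU u hu)
  refine interior_maximal hset (isOpen_of_isOpen_cone ?_) ⟨v, hvU, hv, rfl⟩
  have : {v : Idx n → ℂ | ∃ hv : v ≠ 0, Projectivization.mk ℂ v hv ∈
      {z : PSpace n | ∃ u ∈ U, ∃ hu : u ≠ 0, Projectivization.mk ℂ u hu = z}} =
      -- The cone over the image of U is the union of its nonzero rescalings, hence open.
      (⋃ a : ℂˣ, (fun v : Idx n → ℂ => (a : ℂ) • v) ⁻¹' U) ∩ {v | v ≠ 0} := by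
    ext v
    simp only [Set.mem_inter_iff, Set.mem_iUnion, Set.mem_preimage]
    constructor
    · rintro ⟨hv, u, hu, hu0, huv⟩
      obtain ⟨a, ha⟩ := (Projectivization.mk_eq_mk_iff ℂ _ _ hu0 hv).1 huv
      exact ⟨⟨a, by rw [← Units.smul_def, ha]; exact hu⟩, hv⟩
    · rintro ⟨⟨a, ha⟩, hv⟩
      exact ⟨hv, _, ha, smul_ne_zero a.ne_zero hv,
        (Projectivization.mk_eq_mk_iff ℂ _ _ _ hv).2 ⟨a, rfl⟩⟩
  rw [this]
  exact (isOpen_iUnion fun a => hUo.preimage (continuous_const_smul _)).inter isOpen_ne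

theorem sndNorm_le_of_mk_mem_FRegion {v : Idx n → ℂ} {hv : v ≠ 0}
    (h : Projectivization.mk ℂ v hv ∈ FRegion Γ) {g : PGrp n} (hg : g ∈ Γ) (h1 : g ≠ 1) :
    sndNorm v ≤ movedNorm g v :=
  (mk_mem_iInter_deltaBar hv).1 (interior_subset h) g hg h1

/-- The sets where `‖z''‖` and `‖C_g z' + D_g z''‖` agree have no interior points. -/
theorem TubeDisjoint.exists_movedNorm_ne (hΓ : TubeDisjoint Γ R) {g : PGrp n} (hg : g ∈ Γ)
    (h1 : g ≠ 1) {U : Set (Idx n → ℂ)} (hU : IsOpen U) (hne : U.Nonempty) :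
    ∃ u ∈ U, movedNorm g u ≠ sndNorm u := by
  by_contra! hall
  obtain ⟨v, hv⟩ := hne
  -- Moving along z' fixes ‖z''‖ but shifts the second component y of the image by t a with a = C_g
  -- e₀. Equality at t and -t gives ‖y + ta‖ = ‖y - ta‖ = ‖y‖, so ta = 0 by the parallelogram law.
  let x : Idx n → ℂ := Sum.elim (Pi.single 0 1) 0
  have hcont : Continuous fun t : ℝ => v + (t : ℂ) • x := by fun_prop
  have hev : ∀ᶠ t : ℝ in 𝓝 0, v + (t : ℂ) • x ∈ U :=
    (hU.preimage hcont).mem_nhds (by simpa using hv)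
  have hev' : ∀ᶠ t : ℝ in 𝓝 0, v + ((-t : ℝ) : ℂ) • x ∈ U := by
    have h := (continuous_neg (G := ℝ)).tendsto 0
    rw [neg_zero] at h
    exact h.eventually hev
  obtain ⟨t, ⟨ht, ht'⟩, ht0⟩ := ((hev.and hev').filter_mono nhdsWithin_le_nhds |>.and
    (self_mem_nhdsWithin : ∀ᶠ t in 𝓝[≠] (0 : ℝ), t ≠ 0)).exists
  have hC := hΓ.isUnit_det_blockC hg h1
  set a := (blockC g).mulVec (Pi.single 0 1) with ha
  set y := sndPart ((slMat g).mulVec v) with hy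
  have hval : ∀ s : ℝ, v + (s : ℂ) • x ∈ U → enorm2 (y + (s : ℂ) • a) = enorm2 y := by
    intro s hs
    have e1 : sndPart ((slMat g).mulVec (v + (s : ℂ) • x)) = y + (s : ℂ) • a := by
      rw [Matrix.mulVec_add, Matrix.mulVec_smul, slMat_mulVec, Matrix.mulVec_zero,
        Matrix.mulVec_zero, add_zero, add_zero]
      rfl
    have e2 : sndPart (v + (s : ℂ) • x) = sndPart v := by
      ext i
      simp [sndPart, x]
    have e3 := hall _ hs
    have e4 := hall _ hv
    rw [movedNorm, sndNorm, e1, sndNorm, e2] at e3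
    exact e3.trans e4.symm
  have hp := hval t ht
  have hm := hval (-t) ht'
  have hpar := parallelogram_law_with_norm ℂ (WithLp.toLp 2 y)
    ((t : ℂ) • WithLp.toLp 2 a : EuclideanSpace ℂ (Fin (n + 1)))
  have hp' : ‖WithLp.toLp 2 y + (t : ℂ) • WithLp.toLp 2 a‖ = ‖WithLp.toLp 2 y‖ := hp
  have hm' : ‖WithLp.toLp 2 y - (t : ℂ) • WithLp.toLp 2 a‖ = ‖WithLp.toLp 2 y‖ := by
    rw [sub_eq_add_neg, ← neg_smul, ← Complex.ofReal_neg]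
    exact hm
  rw [hp', hm'] at hpar
  have h0 : ‖(t : ℂ) • (WithLp.toLp 2 a : EuclideanSpace ℂ (Fin (n + 1)))‖ = 0 := by
    have : ‖(t : ℂ) • (WithLp.toLp 2 a : EuclideanSpace ℂ (Fin (n + 1)))‖ *
        ‖(t : ℂ) • (WithLp.toLp 2 a : EuclideanSpace ℂ (Fin (n + 1)))‖ = 0 := by linarith
    exact mul_self_eq_zero.1 this
  rw [norm_smul, mul_eq_zero, norm_eq_zero, Complex.ofReal_eq_zero] at h0
  have ha0 : a = 0 := enorm2_eq_zero.1 (h0.resolve_left ht0)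
  have := congrArg ((blockC g)⁻¹.mulVec) ha0
  rw [ha, Matrix.mulVec_mulVec, Matrix.nonsing_inv_mul _ hC, Matrix.one_mulVec,
    Matrix.mulVec_zero] at this
  simpa using congrFun this 0

theorem movedNorm_inv_mulVec (g : PGrp n) (v : Idx n → ℂ) :
    movedNorm g⁻¹ ((slMat g).mulVec v) = sndNorm v := by
  rw [← movedNorm_mul, inv_mul_cancel, movedNorm_one]

/-- On F ∩ g⁻¹F the condition for g at u and the condition for g⁻¹ at g u are opposite inequalities,
giving equality on an open set. -/
theorem TubeDisjoint.smul_FRegion_inter (hΓ : TubeDisjoint Γ R) {g : PGrp n} (hg : g ∈ Γ)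
    (h1 : g ≠ 1) : ((fun z : PSpace n => g • z) '' FRegion Γ) ∩ FRegion Γ = ∅ := by
  by_contra hne
  obtain ⟨_, ⟨z, hz, rfl⟩, hgz⟩ := Set.nonempty_iff_ne_empty.2 hne
  have hopen : IsOpen (FRegion Γ ∩ (fun z : PSpace n => g • z) ⁻¹' FRegion Γ) :=
    isOpen_interior.inter (isOpen_interior.preimage (continuous_smul_PSpace g))
  obtain ⟨u, ⟨hu0, hu, hgu⟩, hne⟩ := hΓ.exists_movedNorm_ne hg h1 (isOpen_cone hopen)
    ⟨z.rep, z.rep_nonzero, by rw [Projectivization.mk_rep]; exact ⟨hz, hgz⟩⟩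
  refine hne (le_antisymm ?_ (sndNorm_le_of_mk_mem_FRegion hu hg h1))
  rw [Set.mem_preimage, smul_mk_eq] at hgu
  have := sndNorm_le_of_mk_mem_FRegion hgu (Γ.inv_mem hg) (inv_ne_one.2 h1)
  rwa [movedNorm_inv_mulVec] at this

theorem TubeDisjoint.FRegion_nonempty (hΓ : TubeDisjoint Γ R)
    (hK : ∀ g ∈ Γ, g ≠ 1 → opNorm (blockC g)⁻¹ ≤ K) (hK0 : 0 < K) : (FRegion Γ).Nonempty := by
  let x : Idx n → ℂ := Sum.elim (Pi.single 0 1) 0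
  have hx : x ≠ 0 := fun h => by simpa [x] using congrFun h (Sum.inl 0)
  refine ⟨_, mk_mem_FRegion_of_eventually hx ?_⟩
  -- R pays for C_g⁻¹D_g z'' and K for ‖C_g⁻¹‖: here K‖z''‖ < ‖z'‖ - R‖z''‖ ≤ K · `movedNorm g u`,
  -- uniformly in g.
  have hopen : ∀ᶠ u in 𝓝 x, (R + K) * sndNorm u < enorm2 (fstPart u) := by
    refine (isOpen_lt (continuous_const.mul continuous_sndNorm)
      (continuous_enorm2.comp continuous_fstPart)).mem_nhds ?_
    change (R + K) * enorm2 (0 : Fin (n + 1) → ℂ) < enorm2 (Pi.single 0 1)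
    rw [enorm2_zero, mul_zero]
    exact (enorm2_nonneg _).lt_of_ne' fun h => by simpa using congrFun (enorm2_eq_zero.1 h) 0
  filter_upwards [hopen] with u hu g hg h1
  have h2 := hΓ.enorm2_fst_add_coslope_le hg h1 u
  have h3 := hΓ.enorm2_coslope_le hg h1 (sndPart u)
  have h4 : enorm2 (fstPart u) ≤ enorm2 (fstPart u + (coslope g).mulVec (sndPart u)) +
      enorm2 ((coslope g).mulVec (sndPart u)) := by
    have := enorm2_add_le (fstPart u + (coslope g).mulVec (sndPart u))
      (-(coslope g).mulVec (sndPart u))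
    rwa [add_neg_cancel_right, ← zero_sub, enorm2_sub_rev, sub_zero] at this
  have h5 : opNorm (blockC g)⁻¹ * movedNorm g u ≤ K * movedNorm g u :=
    mul_le_mul_of_nonneg_right (hK g hg h1) (enorm2_nonneg _)
  change enorm2 ((coslope g).mulVec (sndPart u)) ≤ R * sndNorm u at h3
  refine le_of_mul_le_mul_left (a := K) ?_ hK0
  linarith

/-! ### The translates of the F-region -/

/-- Near a point of `Ω`, all but finitely many elements of `Γ` increase `‖z''‖`. -/
theorem TubeDisjoint.exists_finset_eventually_lt (hΓ : TubeDisjoint Γ R) (hR : 0 ≤ R)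
    (hK : ∀ g ∈ Γ, g ≠ 1 → opNorm (blockC g)⁻¹ ≤ K) (hspade : Spade Γ) {w : Idx n → ℂ}
    (hw : w ≠ 0) (hmem : Projectivization.mk ℂ w hw ∈ Omega Γ) :
    ∃ t : Finset (PGrp n), 1 ∈ t ∧ (∀ g ∈ t, g ∈ Γ) ∧
      ∀ᶠ u in 𝓝 w, ∀ g ∈ Γ, g ∉ t → sndNorm u < movedNorm g u := by
  classical
  obtain ⟨η, hη, hfin⟩ := hΓ.exists_finite_coslope hR hK hw hmem
  set c := sndNorm w + 1 with hc
  have hc0 : 0 < c := by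
    have : 0 ≤ sndNorm w := enorm2_nonneg _
    linarith
  -- As c bounds ‖z''‖ near w, a non-increasing g with smaller ‖C_g⁻¹‖ gives a gap at most η/2 at u;
  -- passing from u to w adds less than η/2, contradicting the gap η at w.
  have hfin2 := hΓ.finite_opNorm_ge hR hK hspade (ε := η / (2 * c)) (by positivity)
  refine ⟨insert 1 (hfin.toFinset ∪ hfin2.toFinset), Finset.mem_insert_self _ _, ?_, ?_⟩
  · simp only [Finset.mem_insert, Finset.mem_union, Set.Finite.mem_toFinset]
    rintro g (rfl | h | h)
    · exact Γ.one_mem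
    · exact h.1.1
    · exact h.1.1
  have hev1 : ∀ᶠ u in 𝓝 w, sndNorm u < c :=
    continuous_sndNorm.continuousAt.eventually_lt continuousAt_const (by simp [hc])
  have hev2 : ∀ᶠ u in 𝓝 w,
      enorm2 (fstPart w - fstPart u) + R * enorm2 (sndPart w - sndPart u) < η / 2 := by
    have hcont : Continuous fun u : Idx n → ℂ =>
        enorm2 (fstPart w - fstPart u) + R * enorm2 (sndPart w - sndPart u) :=
      (continuous_enorm2.comp (continuous_const.sub continuous_fstPart)).add
        (continuous_const.mul (continuous_enorm2.comp (continuous_const.sub continuous_sndPart)))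
    refine hcont.continuousAt.eventually_lt continuousAt_const ?_
    rw [sub_self, sub_self, enorm2_zero]
    linarith
  filter_upwards [hev1, hev2] with u hu1 hu2 g hg hgt
  simp only [Finset.mem_insert, Finset.mem_union, Set.Finite.mem_toFinset, not_or] at hgt
  obtain ⟨h1, hg1, hg2⟩ := hgt
  by_contra! hle
  have hsmall : opNorm (blockC g)⁻¹ < η / (2 * c) := by
    by_contra! hge
    exact hg2 ⟨⟨hg, h1⟩, hge⟩
  have hfar : η ≤ enorm2 (fstPart w + (coslope g).mulVec (sndPart w)) := by
    by_contra! hlt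
    exact hg1 ⟨⟨hg, h1⟩, hlt⟩
  have h2 := hΓ.enorm2_fst_add_coslope_le hg h1 u
  have h3 : opNorm (blockC g)⁻¹ * movedNorm g u ≤ η / (2 * c) * c :=
    mul_le_mul hsmall.le (hle.trans hu1.le) (enorm2_nonneg _) (by positivity)
  have h4 : η / (2 * c) * c = η / 2 := by field_simp
  have hsplit : fstPart w + (coslope g).mulVec (sndPart w) =
      (fstPart u + (coslope g).mulVec (sndPart u)) +
        ((fstPart w - fstPart u) + (coslope g).mulVec (sndPart w - sndPart u)) := by
    rw [Matrix.mulVec_sub]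
    abel
  have h5 := enorm2_add_le (fstPart u + (coslope g).mulVec (sndPart u))
    ((fstPart w - fstPart u) + (coslope g).mulVec (sndPart w - sndPart u))
  have h6 := enorm2_add_le (fstPart w - fstPart u) ((coslope g).mulVec (sndPart w - sndPart u))
  have h7 := hΓ.enorm2_coslope_le hg h1 (sndPart w - sndPart u)
  rw [← hsplit] at h5
  linarith

/-- For distinct `g, h ∈ Γ` the functions `‖C_g z' + D_g z''‖` and `‖C_h z' + D_h z''‖` differ
on a dense open set. -/
theorem TubeDisjoint.dense_movedNorm_ne (hΓ : TubeDisjoint Γ R) {g h : PGrp n} (hg : g ∈ Γ)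
    (hh : h ∈ Γ) (hne : g ≠ h) : Dense {u : Idx n → ℂ | movedNorm g u ≠ movedNorm h u} := by
  refine dense_iff_inter_open.2 fun U hU hUne => ?_
  have hpre : IsOpen ((fun v : Idx n → ℂ => ((slMat h)⁻¹).mulVec v) ⁻¹' U) :=
    hU.preimage (continuous_const.matrix_mulVec continuous_id)
  obtain ⟨u₀, hu₀⟩ := hUne
  obtain ⟨v, hv, hvne⟩ := hΓ.exists_movedNorm_ne (Γ.mul_mem hg (Γ.inv_mem hh))
    (fun h1 => hne (mul_inv_eq_one.1 h1)) hpre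
    ⟨(slMat h).mulVec u₀, by rw [Set.mem_preimage, slMat_inv_mulVec_mulVec]; exact hu₀⟩
  refine ⟨_, hv, ?_⟩
  have h1 := movedNorm_mul (g * h⁻¹) h (((slMat h)⁻¹).mulVec v)
  rw [inv_mul_cancel_right, slMat_mulVec_inv_mulVec] at h1
  have h2 : movedNorm h (((slMat h)⁻¹).mulVec v) = sndNorm v := by
    rw [movedNorm, slMat_mulVec_inv_mulVec]
  change movedNorm g _ ≠ movedNorm h _
  rwa [h1, h2]

/-- The translates of the closure of the F-region cover `Ω`. -/
theorem TubeDisjoint.exists_smul_mem_closure (hΓ : TubeDisjoint Γ R) (hR : 0 ≤ R)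
    (hK : ∀ g ∈ Γ, g ≠ 1 → opNorm (blockC g)⁻¹ ≤ K) (hspade : Spade Γ) {z : PSpace n}
    (hz : z ∈ Omega Γ) : ∃ g ∈ Γ, g • z ∈ closure (FRegion Γ) := by
  induction z using Projectivization.ind with | h w hw => ?_
  obtain ⟨t, h1t, htΓ, hev⟩ := hΓ.exists_finset_eventually_lt hR hK hspade hw hz
  obtain ⟨U, hU, hUo, hwU⟩ := eventually_nhds_iff.1 (hev.and (isOpen_ne.mem_nhds hw))
  -- The open set where g is the strict winner among the finitely many competitors in t.
  let cell : PGrp n → Set (Idx n → ℂ) := fun g =>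
    U ∩ {u | ∀ h ∈ t, h ≠ g → movedNorm g u < movedNorm h u}
  have hcell_open : ∀ g, IsOpen (cell g) := fun g => by
    have : {u : Idx n → ℂ | ∀ h ∈ t, h ≠ g → movedNorm g u < movedNorm h u} =
        ⋂ h ∈ t, ⋂ _ : h ≠ g, {u | movedNorm g u < movedNorm h u} := by
      ext u
      simp only [Set.mem_iInter]
      rfl
    refine hUo.inter ?_
    rw [this]
    exact isOpen_biInter_finset fun h _ => isOpen_iInter_of_finite fun _ =>
      isOpen_lt (continuous_movedNorm g) (continuous_movedNorm h)
  have hgeneric : Dense (⋂ p ∈ {p : PGrp n × PGrp n | p ∈ t ×ˢ t ∧ p.1 ≠ p.2},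
      {u : Idx n → ℂ | movedNorm p.1 u ≠ movedNorm p.2 u}) := by
    refine dense_biInter_of_isOpen (fun p _ =>
      isOpen_ne_fun (continuous_movedNorm p.1) (continuous_movedNorm p.2)) ?_ ?_
    · exact ((t ×ˢ t).finite_toSet.subset fun p hp => hp.1).countable
    · rintro p ⟨hp, hne⟩
      obtain ⟨hp1, hp2⟩ := Finset.mem_product.1 hp
      exact hΓ.dense_movedNorm_ne (htΓ _ hp1) (htΓ _ hp2) hne
  have hcover : U ∩ (⋂ p ∈ {p : PGrp n × PGrp n | p ∈ t ×ˢ t ∧ p.1 ≠ p.2},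
      {u : Idx n → ℂ | movedNorm p.1 u ≠ movedNorm p.2 u}) ⊆ ⋃ g ∈ t, cell g := by
    rintro u ⟨huU, hu⟩
    obtain ⟨g, hgt, hmin⟩ := t.exists_min_image (fun g => movedNorm g u) ⟨1, h1t⟩
    refine Set.mem_iUnion₂.2 ⟨g, hgt, huU, fun h hh hne => (hmin h hh).lt_of_ne ?_⟩
    exact Set.mem_iInter₂.1 hu (g, h) ⟨Finset.mem_product.2 ⟨hgt, hh⟩, hne.symm⟩
  have hwcl : w ∈ closure (⋃ g ∈ t, cell g) :=
    closure_mono hcover (hgeneric.open_subset_closure_inter hUo hwU)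
  rw [t.closure_biUnion] at hwcl
  obtain ⟨g, hgt, hwg⟩ := Set.mem_iUnion₂.1 hwcl
  have hgΓ := htΓ g hgt
  refine ⟨g, hgΓ, ?_⟩
  have hmem : ∀ u ∈ cell g, ∀ hu : u ≠ 0, g • Projectivization.mk ℂ u hu ∈ FRegion Γ := by
    intro u hu hu0
    rw [smul_mk_eq]
    refine mk_mem_FRegion_of_eventually _ ?_
    have hpre : IsOpen ((fun v : Idx n → ℂ => ((slMat g)⁻¹).mulVec v) ⁻¹' cell g) :=
      (hcell_open g).preimage (continuous_const.matrix_mulVec continuous_id)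
    filter_upwards [hpre.mem_nhds (by rwa [Set.mem_preimage, slMat_inv_mulVec_mulVec])]
      with v hv h hh hh1
    obtain ⟨hvU, hvmin⟩ := hv
    set u' := ((slMat g)⁻¹).mulVec v with hu'
    have e1 : sndNorm v = movedNorm g u' := by
      rw [movedNorm, hu', slMat_mulVec_inv_mulVec]
    have e2 : movedNorm h v = movedNorm (h * g) u' := by
      rw [movedNorm_mul, hu', slMat_mulVec_inv_mulVec]
    rw [e1, e2]
    have hne : h * g ≠ g := fun h' => hh1 (mul_eq_right.1 h')
    by_cases hht : h * g ∈ t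
    · exact (hvmin _ hht hne).le
    -- Elements outside t already lose to the identity, which belongs to t and so does not beat g.
    · have h3 := (hU u' hvU).1 (h * g) (Γ.mul_mem hh hgΓ) hht
      refine le_trans ?_ h3.le
      by_cases hg1 : g = 1
      · rw [hg1, movedNorm_one]
      · rw [← movedNorm_one]
        exact (hvmin 1 h1t (Ne.symm hg1)).le
  refine mem_closure_iff.2 fun W hW hgW => ?_
  obtain ⟨u, ⟨hu0, huW⟩, hucell⟩ := mem_closure_iff.1 hwg _
    (isOpen_cone (hW.preimage (continuous_smul_PSpace g))) ⟨hw, hgW⟩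
  exact ⟨_, huW, hmem u hucell hu0⟩

/-- If z were in F, the open set gF would be a neighbourhood of a point of the closure of F, so it
would meet F. -/
theorem TubeDisjoint.notMem_FRegion (hΓ : TubeDisjoint Γ R) {g : PGrp n} (hg : g ∈ Γ)
    (h1 : g ≠ 1) {z : PSpace n} (hz : g • z ∈ closure (FRegion Γ)) : z ∉ FRegion Γ := fun h => by
  have hne := mem_closure_iff.1 hz ((fun z : PSpace n => g • z) '' FRegion Γ)
    (isOpen_image_smul g isOpen_interior) ⟨z, h, rfl⟩
  rw [hΓ.smul_FRegion_inter hg h1] at hne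
  exact Set.not_nonempty_empty hne

end TypeL

/-! ### Assembly of the four assertions -/

theorem theorem5p1 (n : ℕ) (hn : 1 ≤ n) (Γ : Subgroup (TypeL.PGrp n))
    (hL : TypeL.IsTypeL Γ)
    (hcoord : TypeL.IsAdapted Γ)
    (htf : ∀ g ∈ Γ, g ≠ 1 → ¬ IsOfFinOrder g)
    (hclub : TypeL.Club Γ) (hspade : TypeL.Spade Γ) :
    (∀ g ∈ Γ, ((fun z : TypeL.PSpace n => g • z) '' TypeL.FRegion Γ ⊆ TypeL.FRegion Γ ↔ g = 1)) ∧
    (∀ g ∈ Γ, g ≠ 1 →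
      ((fun z : TypeL.PSpace n => g • z) '' TypeL.FRegion Γ) ∩ TypeL.FRegion Γ = ∅) ∧
    (∀ z ∈ TypeL.Omega Γ, ∃ g ∈ Γ, g • z ∈ TypeL.Omega Γ ∩ closure (TypeL.FRegion Γ)) ∧
    (∀ z ∈ TypeL.Omega Γ ∩ closure (TypeL.FRegion Γ),
      ∀ w ∈ TypeL.Omega Γ ∩ closure (TypeL.FRegion Γ), ∀ g ∈ Γ, g ≠ 1 → w = g • z →
        z ∈ TypeL.Omega Γ ∩ (closure (TypeL.FRegion Γ) \ TypeL.FRegion Γ) ∧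
        w ∈ TypeL.Omega Γ ∩ (closure (TypeL.FRegion Γ) \ TypeL.FRegion Γ)) := by
  obtain ⟨R, hR, -, hdisj⟩ := hcoord
  have hΓ : TypeL.TubeDisjoint Γ R := hdisj
  obtain ⟨K, hK0, hK'⟩ := hclub.exists_pos_norm_le
  have hK : ∀ g ∈ Γ, g ≠ 1 → TypeL.opNorm (TypeL.blockC g)⁻¹ ≤ K := fun g hg h1 =>
    (le_abs_self _).trans (hK' _ ⟨g, hg, h1, rfl⟩)
  refine ⟨fun g hg => ⟨fun hsub => ?_, ?_⟩, fun g hg h1 => hΓ.smul_FRegion_inter hg h1,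
    fun z hz => ?_, ?_⟩
  · by_contra h1
    -- Nonemptiness is what makes the inclusion gF ⊂ F incompatible with disjointness.
    obtain ⟨z, hz⟩ := hΓ.FRegion_nonempty hK hK0
    have hmem : g • z ∈ ((fun z : TypeL.PSpace n => g • z) '' TypeL.FRegion Γ) ∩
        TypeL.FRegion Γ := ⟨⟨z, hz, rfl⟩, hsub ⟨z, hz, rfl⟩⟩
    rw [hΓ.smul_FRegion_inter hg h1] at hmem
    exact hmem
  · rintro rfl
    simp
  · obtain ⟨g, hg, hgz⟩ := hΓ.exists_smul_mem_closure hR.le hK hspade hz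
    exact ⟨g, hg, TypeL.smul_mem_Omega hg hz, hgz⟩
  · rintro z ⟨hzΩ, hz⟩ w ⟨hwΩ, hw⟩ g hg h1 rfl
    refine ⟨⟨hzΩ, hz, hΓ.notMem_FRegion hg h1 hw⟩, hwΩ, hw, ?_⟩
    refine hΓ.notMem_FRegion (Γ.inv_mem hg) (inv_ne_one.2 h1) ?_
    rwa [inv_smul_smul]
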